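/- Bandit problem. The arm space is $[0,1]$. The environment fixes a (measurable) function $f:[0,1]\to[0,1]$. In each round $t=1,\dots,T$ the player chooses an arm $X_t\in[0,1]$ and receives a reward $Y_t$ such that, conditionally on the past and on $X_t$, the mean of $Y_t$ is $f(X_t)$ and the noise is $\frac14$-subgaussian: $\mathbb E\big[e^{s(Y_t-f(X_t))}\mid \text{past},X_t\big]\le e^{s^2/8}$ for all $s\in\mathbb R$. Write $M(f)=\sup f$, and let $\overline R_T=T\,M(f)-\mathbb E\big[\sum_{t=1}^T Y_t\big]$ be the expected regret. For $\alpha,L>0$ let $\mathcal H(L,\alpha)$ be the set of those $f$ for which there is $x^\star\in[0,1]$ with $f(x^\star)=M(f)$ and $|f(x^\star)-f(x)|\le L|x^\star-x|^\alpha$ for all $x\in[0,1]$. MOSS with $K$ arms and horizon $H$ selects in each round an arm that maximizes the index $\hat\mu_a+\sqrt{\frac1{N_a}\log_+\frac{H}{K N_a}}$ (ties are broken arbitrarily), where $N_a$ is the number of earlier plays of the arm $a$, $\hat\mu_a$ is the average reward received from them, $\log_+=\max(\log,0)$, and the index is $+\infty$ if $N_a=0$. MeDZO with input $B$ and horizon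 $T$: put $p=\lceil\log_2 B\rceil$, and for $i=1,\dots,p$ put $K_i=2^{p+2-i}$ and $\Delta T_i=2^{p+i}$. The rounds are divided into successive regimes $i=1,\dots,p$ of lengths $\Delta T_i$, and the algorithm stops after round $T$. In regime $i$ there are $K_i+i-1$ discrete arms, to each of which a probability measure is attached: the uniform measures on the intervals $[(k-1)/K_i,k/K_i]$, $1\le k\le K_i$, and the empirical measures $\hat\nu_j$ of the arms played in the regimes $j<i$. In each round of regime $i$, a discrete arm is selected by MOSS with these $K_i+i-1$ arms and horizon $\Delta T_i$, started afresh at the beginning of the regime; then $X_t$ is drawn from the measure attached to the selected discrete arm, and $Y_t$ is passed to MOSS as the reward of that discrete arm. Corollary. Let $T\ge2$ be an integer and run MeDZO with horizon $T$ and $B=\sqrt T$. Then for all $\alpha>0$ and $L>1/\sqrt T$, $$\sup_{f\in\mathcal H(L,\alpha)}\overline R_T\;\le\;146\,(\log_2T)^{3/2}\,L^{1/(\alpha+1)}\,T^{(\alpha+2)/(2\alpha+2)}.$$ -/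

import Mathlib

open MeasureTheory ProbabilityTheory

noncomputable section

namespace Medzo

/-- The arm space `[0,1]`. -/
abbrev Arm : Type := unitInterval

/-- The maximal value `M(f)` of a mean-payoff function. -/
def maxValue (f : Arm → ℝ) : ℝ := ⨆ x, f x

/-- The class `H(L, α)`: functions from `[0,1]` to `[0,1]` which attain their maximum at some point
around which they satisfy a Hölder condition with constant `L` and exponent `α`. -/
def holderClass (L α : ℝ) : Set (Arm → ℝ) :=
  {f | (∀ x, f x ∈ Set.Icc (0 : ℝ) 1) ∧
    ∃ xs : Arm, f xs = maxValue f ∧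
      ∀ x : Arm, |f xs - f x| ≤ L * |(xs : ℝ) - (x : ℝ)| ^ α}

/-! ### The finite-armed algorithm MOSS -/

/-- Number of times arm `b` was played in the first `n` rounds (rounds are numbered from `0`), when
`a s` is the arm played in round `s`. -/
def playCount (a : ℕ → ℕ) (n b : ℕ) : ℕ := ((Finset.range n).filter (fun s => a s = b)).card

/-- Average reward collected with arm `b` in the first `n` rounds. -/
def empMean (a : ℕ → ℕ) (y : ℕ → ℝ) (n b : ℕ) : ℝ :=
  (∑ s ∈ (Finset.range n).filter (fun s => a s = b), y s) / playCount a n b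

/-- The MOSS index of arm `b` after `n` rounds, for `K` arms and horizon `H`: it is infinite
for an arm not played yet, and otherwise it is
`empirical mean + sqrt (log₊ (H / (K N)) / N)`, where `N` is the number of plays of `b`. -/
def mossIndex (K H : ℕ) (a : ℕ → ℕ) (y : ℕ → ℝ) (n b : ℕ) : EReal :=
  if playCount a n b = 0 then ⊤
  else ((empMean a y n b +
    Real.sqrt (Real.posLog ((H : ℝ) / ((K : ℝ) * (playCount a n b : ℝ))) /
      (playCount a n b : ℝ)) : ℝ) : EReal)

/-- The arm `a n` played in round `n` is one prescribed by MOSS, with arms `0, …, K - 1` and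
horizon `H`: it maximizes the index given the first `n` rounds (ties broken arbitrarily). -/
def IsMossChoice (K H : ℕ) (a : ℕ → ℕ) (y : ℕ → ℝ) (n : ℕ) : Prop :=
  a n < K ∧ ∀ b < K, mossIndex K H a y n b ≤ mossIndex K H a y n (a n)

/-! ### The regimes of MeDZO -/

/-- `p = ⌈log₂ B⌉`, the number of regimes. -/
def numRegimes (B : ℝ) : ℕ := ⌈Real.logb 2 B⌉₊

/-- `K_i = 2 ^ (p + 2 - i)`, the number of cells of the partition in regime `i ∈ {1, …, p}`. -/
def numCells (p i : ℕ) : ℕ := 2 ^ (p + 2 - i)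

/-- `ΔT_i = 2 ^ (p + i)`, the length of regime `i`. -/
def regimeLength (p i : ℕ) : ℕ := 2 ^ (p + i)

/-- Total length of the regimes `1, …, i - 1`; with rounds numbered from `0`, this is the first
round of regime `i`. -/
def regimeStart (p i : ℕ) : ℕ := ∑ j ∈ Finset.Ico 1 i, regimeLength p j

/-- Round `t` belongs to regime `i`. -/
def InRegime (p i t : ℕ) : Prop :=
  1 ≤ i ∧ i ≤ p ∧ regimeStart p i ≤ t ∧ t < regimeStart p (i + 1)

/-- The uniform probability measure on the cell `[c / K, (c + 1) / K]`. -/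
def uniformCell (K c : ℕ) : Measure Arm :=
  ProbabilityTheory.cond (volume : Measure Arm)
    {x : Arm | (c : ℝ) / K ≤ (x : ℝ) ∧ (x : ℝ) ≤ ((c : ℝ) + 1) / K}

/-- The empirical measure of the arms played during regime `j`, when `x t` is the arm played in
round `t`. -/
def empiricalMeasure (p j : ℕ) (x : ℕ → Arm) : Measure Arm :=
  (regimeLength p j : ENNReal)⁻¹ •
    ∑ t ∈ Finset.Ico (regimeStart p j) (regimeStart p (j + 1)), Measure.dirac (x t)

/-- Number of discrete arms in regime `i`: the `K_i` cells and the regimes `1, …, i - 1`. -/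
def numArms (p i : ℕ) : ℕ := numCells p i + (i - 1)

/-- The probability measure attached to the discrete arm `c` of regime `i`: for `c < K_i`, the
uniform measure on the cell number `c`; for `c = K_i + (j - 1)` with `1 ≤ j < i`, the empirical
measure of the plays of regime `j`. -/
def armMeasure (p i : ℕ) (x : ℕ → Arm) (c : ℕ) : Measure Arm :=
  if c < numCells p i then uniformCell (numCells p i) c
  else empiricalMeasure p (c - numCells p i + 1) x

/-! ### The interaction of player and environment -/

variable {Ω : Type*} [MeasurableSpace Ω]

/-- The σ-algebra generated by the triples `(I_s, X_s, Y_s)` for `s < t`. -/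
abbrev history (I : ℕ → Ω → ℕ) (X : ℕ → Ω → Arm) (Y : ℕ → Ω → ℝ) (t : ℕ) : MeasurableSpace Ω :=
  ⨆ s : Fin t, MeasurableSpace.comap (fun ω => (I s ω, X s ω, Y s ω)) inferInstance

/-- The σ-algebra generated by the past of round `t` and `I_t`. -/
abbrev historyI (I : ℕ → Ω → ℕ) (X : ℕ → Ω → Arm) (Y : ℕ → Ω → ℝ) (t : ℕ) : MeasurableSpace Ω :=
  history I X Y t ⊔ MeasurableSpace.comap (I t) inferInstance

/-- The σ-algebra generated by the past of round `t`, `I_t` and `X_t`. -/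
abbrev historyIX (I : ℕ → Ω → ℕ) (X : ℕ → Ω → Arm) (Y : ℕ → Ω → ℝ) (t : ℕ) : MeasurableSpace Ω :=
  historyI I X Y t ⊔ MeasurableSpace.comap (X t) inferInstance

/-- The rewards `Y_t`, `t < T`, are generated by a stochastic environment with mean-payoff `f`:
given the past and the chosen arm `X_t`, the reward has mean `f (X_t)` and the noise
`Y_t - f (X_t)` is `1/4`-subgaussian. -/
structure IsEnvironment (f : Arm → ℝ) (T : ℕ) (P : Measure Ω)
    (I : ℕ → Ω → ℕ) (X : ℕ → Ω → Arm) (Y : ℕ → Ω → ℝ) : Prop where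
  measurable_reward : ∀ t, Measurable (Y t)
  integrable_reward : ∀ t < T, Integrable (Y t) P
  mean_reward : ∀ t < T, P[Y t | historyIX I X Y t] =ᵐ[P] fun ω => f (X t ω)
  integrable_exp : ∀ t < T, ∀ s : ℝ,
    Integrable (fun ω => Real.exp (s * (Y t ω - f (X t ω)))) P
  subgaussian : ∀ t < T, ∀ s : ℝ,
    P[fun ω => Real.exp (s * (Y t ω - f (X t ω))) | historyIX I X Y t]
      ≤ᵐ[P] fun _ => Real.exp ((1 / 4) * s ^ 2 / 2)

/-- The player follows the algorithm MeDZO with input `B` during the rounds `t < T`. In each round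
of regime `i`, the discrete arm `I_t` is selected by MOSS (started afresh at the beginning of the
regime, with horizon the length of the regime), and then `X_t` is drawn from the measure attached
to `I_t`. -/
structure IsMedzo (B : ℝ) (T : ℕ) (P : Measure Ω)
    (I : ℕ → Ω → ℕ) (X : ℕ → Ω → Arm) (Y : ℕ → Ω → ℝ) : Prop where
  measurable_index : ∀ t, Measurable (I t)
  measurable_arm : ∀ t, Measurable (X t)
  choice : ∀ i t, InRegime (numRegimes B) i t → t < T → ∀ᵐ ω ∂P,
    IsMossChoice (numArms (numRegimes B) i) (regimeLength (numRegimes B) i)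
      (fun s => I (regimeStart (numRegimes B) i + s) ω)
      (fun s => Y (regimeStart (numRegimes B) i + s) ω)
      (t - regimeStart (numRegimes B) i)
  draw : ∀ i t, InRegime (numRegimes B) i t → t < T →
    ∀ g : Arm → ℝ, Measurable g → (∃ C : ℝ, ∀ x, |g x| ≤ C) →
      P[fun ω => g (X t ω) | historyI I X Y t] =ᵐ[P]
        fun ω => ∫ x, g x ∂(armMeasure (numRegimes B) i (fun s => X s ω) (I t ω))

/-- The expected cumulative regret at time `T`: `T M(f) - E[Y_1 + ⋯ + Y_T]`. -/
def regret (f : Arm → ℝ) (T : ℕ) (P : Measure Ω) (Y : ℕ → Ω → ℝ) : ℝ :=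
  (T : ℝ) * maxValue f - ∫ ω, (∑ t ∈ Finset.range T, Y t ω) ∂P

end Medzo

end

/-! ### A maximal inequality for the noise of one arm. -/

namespace Medzo

variable {Ω : Type*}

/-! MeDZO zooms out: partitions get coarser and regimes longer, while the empirical measures retain
what earlier regimes achieved. The product of the number of cells and the regime length is always `2
^ (2p + 2)`, and at most `p - 1` memory arms are added. Hence a distribution-free bound `29 √(K H)`
for MOSS makes every regime cost at most `s = 29 · 2 ^ (p + 1) √p` against any of its discrete arms
(`regime_regret_le`, `numArms_mul_regimeLength_le`).

Fix the regime `j` with `2 ^ m` cells. Up to `j`, a cell containing a maximizer has mean within `D =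
L 2 ^ (-mα)` of the maximum (`exists_cell_mean_ge`). After `j`, the memory arm of `j` has as
expected gap the average regret of regime `j`, at most `D + s / ΔT_j`. Summing gives `T (D + s /
ΔT_j) + p s` (`regret_le_of_scale`), and `2 ^ m ≈ (L √T) ^ (1 / (α + 1))` balances the terms; only
the analysis has to know `m`.

The reward of a discrete arm carries the `1/4`-subgaussian noise and the randomness of the draw,
also `1/4`-subgaussian by Hoeffding's lemma: `1/2` in total (`subgaussian_feedback`). The means of
memory arms are random but known when the regime starts, so MOSS sees an ordinary finite-armed
bandit.

The bound for MOSS (`moss_regret_le`) is proved directly in expectation. For each `θ`, the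
exponentials `exp (θ S - θ² N / 3)` are dominated uniformly in time by a variable of mean at most
`4` (`exists_exp_le`). The inequality `u ≤ exp (s u - 1) / s` converts these into linear bounds on
the deviations, with `θ` tuned to the number of plays, and these are summed over the rounds pathwise
before integrating. -/

/-- The set inequalities compare the measures with densities `g` and `h` on `m`. Working in
`ENNReal` spares any integrability condition on the weight `W`, which will be an unbounded
exponential. -/
theorem lintegral_mul_le_of_setLIntegral_le {m m0 : MeasurableSpace Ω} {P : Measure Ω}
    (hm : m ≤ m0) {g h : Ω → ENNReal} (hg : Measurable g) (hh : Measurable h)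
    (hset : ∀ A, MeasurableSet[m] A → ∫⁻ ω in A, g ω ∂P ≤ ∫⁻ ω in A, h ω ∂P)
    {W : Ω → ENNReal} (hW : Measurable[m] W) :
    ∫⁻ ω, W ω * g ω ∂P ≤ ∫⁻ ω, W ω * h ω ∂P := by
  have key : (P.withDensity g).trim hm ≤ (P.withDensity h).trim hm := by
    refine Measure.le_iff.2 fun A hA => ?_
    rw [trim_measurableSet_eq hm hA, trim_measurableSet_eq hm hA,
      withDensity_apply _ (hm A hA), withDensity_apply _ (hm A hA)]
    exact hset A hA
  have hrew : ∀ {φ : Ω → ENNReal}, Measurable φ →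
      ∫⁻ ω, W ω * φ ω ∂P = ∫⁻ ω, W ω ∂(P.withDensity φ).trim hm := by
    intro φ hφ
    rw [lintegral_trim hm hW, lintegral_withDensity_eq_lintegral_mul P hφ (hW.mono hm le_rfl)]
    simp [mul_comm]
  rw [hrew hg, hrew hh]
  exact lintegral_mono' key le_rfl

theorem lintegral_mul_ofReal_le_of_condExp_le {m m0 : MeasurableSpace Ω} {P : Measure Ω}
    [IsFiniteMeasure P] (hm : m ≤ m0) {g h : Ω → ℝ} (hgm : Measurable g) (hg : Integrable g P)
    (hg0 : ∀ ω, 0 ≤ g ω) (hle : P[g|m] ≤ᵐ[P] h) {W : Ω → ENNReal} (hW : Measurable[m] W) :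
    ∫⁻ ω, W ω * ENNReal.ofReal (g ω) ∂P ≤ ∫⁻ ω, W ω * ENNReal.ofReal (h ω) ∂P := by
  have hc0 : 0 ≤ᵐ[P] P[g|m] := condExp_nonneg (Filter.Eventually.of_forall hg0)
  calc ∫⁻ ω, W ω * ENNReal.ofReal (g ω) ∂P
      ≤ ∫⁻ ω, W ω * ENNReal.ofReal ((P[g|m]) ω) ∂P := by
        refine lintegral_mul_le_of_setLIntegral_le hm hgm.ennreal_ofReal
          (stronglyMeasurable_condExp.measurable.mono hm le_rfl).ennreal_ofReal ?_ hW
        intro A hA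
        rw [← ofReal_integral_eq_lintegral_ofReal hg.integrableOn
            (Filter.Eventually.of_forall hg0),
          ← ofReal_integral_eq_lintegral_ofReal integrable_condExp.integrableOn
            (ae_restrict_of_ae hc0), setIntegral_condExp hm hg hA]
    _ ≤ _ := by
        refine lintegral_mono_ae ?_
        filter_upwards [hle] with ω hω
        gcongr

/-- Cumulated noise of arm `b` in the first `t` rounds, with mean `μ`. -/
noncomputable def noiseSum (a : ℕ → ℕ) (y : ℕ → ℝ) (μ : ℝ) (b t : ℕ) : ℝ :=
  ∑ s ∈ (Finset.range t).filter (fun s => a s = b), (y s - μ)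

theorem playCount_succ (a : ℕ → ℕ) (t b : ℕ) :
    playCount a (t + 1) b = playCount a t b + if a t = b then 1 else 0 := by
  unfold playCount
  rw [Finset.range_add_one, Finset.filter_insert]
  split_ifs <;> simp

theorem noiseSum_succ (a : ℕ → ℕ) (y : ℕ → ℝ) (μ : ℝ) (b t : ℕ) :
    noiseSum a y μ b (t + 1) = noiseSum a y μ b t + if a t = b then y t - μ else 0 := by
  unfold noiseSum
  rw [Finset.range_add_one, Finset.filter_insert]
  split_ifs
  · rw [Finset.sum_insert (by simp), add_comm]
  · simp

theorem noiseSum_eq (a : ℕ → ℕ) (y : ℕ → ℝ) (μ : ℝ) (b t : ℕ) (h : playCount a t b ≠ 0) :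
    noiseSum a y μ b t / playCount a t b = empMean a y t b - μ := by
  have : (playCount a t b : ℝ) ≠ 0 := by exact_mod_cast h
  unfold noiseSum empMean
  rw [Finset.sum_sub_distrib, Finset.sum_const, nsmul_eq_mul, ← playCount]
  field_simp

/-- Logarithm of the exponential supermartingale of arm `b`. -/
noncomputable def logSuper (lam : ℝ) (a : ℕ → ℕ) (y : ℕ → ℝ) (μ : ℝ) (b t : ℕ) : ℝ :=
  lam * noiseSum a y μ b t - lam ^ 2 / 4 * playCount a t b

theorem logSuper_succ (lam : ℝ) (a : ℕ → ℕ) (y : ℕ → ℝ) (μ : ℝ) (b t : ℕ) :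
    logSuper lam a y μ b (t + 1) = logSuper lam a y μ b t +
      if a t = b then lam * (y t - μ) - lam ^ 2 / 4 else 0 := by
  unfold logSuper
  rw [noiseSum_succ, playCount_succ]
  split_ifs <;> push_cast <;> ring

theorem measurable_logSuper {m : MeasurableSpace Ω} (lam : ℝ) {a : ℕ → Ω → ℕ} {y : ℕ → Ω → ℝ}
    {μ : Ω → ℝ} (b t : ℕ) (ha : ∀ s < t, Measurable (a s)) (hy : ∀ s < t, Measurable (y s))
    (hμ : Measurable μ) :
    Measurable fun ω => logSuper lam (fun s => a s ω) (fun s => y s ω) (μ ω) b t := by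
  induction t with
  | zero => simp [logSuper, noiseSum, playCount]
  | succ t ih =>
    simp only [logSuper_succ]
    refine (ih (fun s hs => ha s (by omega)) fun s hs => hy s (by omega)).add
      (Measurable.ite (ha t (by omega) (measurableSet_singleton b)) ?_ measurable_const)
    exact (((hy t (by omega)).sub hμ).const_mul _).sub_const _

theorem measurable_partialSups {m : MeasurableSpace Ω} {x : ℕ → Ω → ℝ} (t : ℕ)
    (hx : ∀ s ≤ t, Measurable (x s)) : Measurable fun ω => partialSups (fun s => x s ω) t := by
  induction t with
  | zero => simpa using hx 0 le_rfl
  | succ t ih =>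
    simp only [partialSups_add_one]
    exact (ih fun s hs => hx s (by omega)).sup (hx _ le_rfl)

/-- Weighted AM-GM: with `z = exp ((x - X) / 4)` it reads `4 z³ ≤ 1 + 3 z⁴`, and the difference is
`(z - 1)² (3 z² + 2 z + 1)`. -/
theorem four_mul_exp_le (x X : ℝ) :
    4 * Real.exp (3 * x / 4) ≤ Real.exp (3 * X / 4) + 3 * Real.exp (x - X / 4) := by
  have e1 : Real.exp (3 * x / 4) = Real.exp (3 * X / 4) * Real.exp ((x - X) / 4) ^ 3 := by
    rw [← Real.exp_nat_mul, ← Real.exp_add]; congr 1; push_cast; ring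
  have e2 : Real.exp (x - X / 4) = Real.exp (3 * X / 4) * Real.exp ((x - X) / 4) ^ 4 := by
    rw [← Real.exp_nat_mul, ← Real.exp_add]; congr 1; push_cast; ring
  rw [e1, e2]
  set z := Real.exp ((x - X) / 4)
  have hz : 0 ≤ z := (Real.exp_pos _).le
  have h1 : 0 ≤ (z - 1) ^ 2 * (3 * z ^ 2 + 2 * z + 1) := by positivity
  have h2 := mul_nonneg (Real.exp_pos (3 * X / 4)).le h1
  nlinarith [h2]

/-- Control function of the running maximum `X` of a supermartingale `exp x`. -/
noncomputable def doobPot (x : ℕ → ℝ) (t : ℕ) : ℝ :=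
  Real.exp (3 * partialSups x t / 4) + 3 * Real.exp (x t - partialSups x t / 4)

/-- Raising the running maximum only lowers the potential, so it may be frozen during one step. What
remains is affine in `exp (x (t + 1))`, to which the supermartingale property applies. -/
theorem doobPot_succ_le (x : ℕ → ℝ) (t : ℕ) :
    doobPot x (t + 1) ≤ Real.exp (3 * partialSups x t / 4) +
      3 * Real.exp (x (t + 1) - partialSups x t / 4) := by
  unfold doobPot
  rw [partialSups_add_one]
  rcases le_total (x (t + 1)) (partialSups x t) with h | h
  · rw [sup_eq_left.2 h]
  · rw [sup_eq_right.2 h]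
    have := four_mul_exp_le (x (t + 1)) (partialSups x t)
    have e : x (t + 1) - x (t + 1) / 4 = 3 * x (t + 1) / 4 := by ring
    rw [e]; linarith

/-- The feedback of a finite-armed bandit algorithm: in round `t < n`, given the σ-algebra `F t`
containing the past and the choice `a t`, the reward of arm `b` has mean `μ b`, up to a noise which
is `1/2`-subgaussian. -/
structure IsFeedback [m0 : MeasurableSpace Ω] (P : Measure Ω) (F : ℕ → MeasurableSpace Ω) (K n : ℕ)
    (a : ℕ → Ω → ℕ) (y : ℕ → Ω → ℝ) (μ : ℕ → Ω → ℝ) : Prop where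
  le : ∀ t, F t ≤ m0
  measurable_arm : ∀ t, ∀ s ≤ t, Measurable[F t] (a s)
  measurable_reward : ∀ t, ∀ s < t, Measurable[F t] (y s)
  measurable_mean : ∀ t, ∀ b < K, Measurable[F t] (μ b)
  subgaussian : ∀ t < n, ∀ b < K, ∀ s : ℝ, ∀ A, MeasurableSet[F t] A → (∀ ω ∈ A, a t ω = b) →
    ∫⁻ ω in A, ENNReal.ofReal (Real.exp (s * (y t ω - μ b ω))) ∂P
      ≤ ENNReal.ofReal (Real.exp (s ^ 2 / 4)) * P A

variable [m0 : MeasurableSpace Ω] {P : Measure Ω} {F : ℕ → MeasurableSpace Ω} {K n : ℕ}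
  {a : ℕ → Ω → ℕ} {y : ℕ → Ω → ℝ} {μ : ℕ → Ω → ℝ}

theorem IsFeedback.measurable_all (hF : IsFeedback P F K n a y μ) :
    (∀ t, Measurable (a t)) ∧ (∀ t, Measurable (y t)) ∧ ∀ b < K, Measurable (μ b) :=
  ⟨fun t => (hF.measurable_arm t t le_rfl).mono (hF.le t) le_rfl,
    fun t => (hF.measurable_reward (t + 1) t (by omega)).mono (hF.le _) le_rfl,
    fun b hb => (hF.measurable_mean 0 b hb).mono (hF.le 0) le_rfl⟩

theorem IsFeedback.lintegral_step (hF : IsFeedback P F K n a y μ) {b t : ℕ} (hb : b < K)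
    (ht : t < n) (lam : ℝ) {W : Ω → ENNReal} (hW : Measurable[F t] W) :
    ∫⁻ ω, W ω * ENNReal.ofReal
        (Real.exp (if a t ω = b then lam * (y t ω - μ b ω) - lam ^ 2 / 4 else 0)) ∂P
      ≤ ∫⁻ ω, W ω ∂P := by
  obtain ⟨ha, hy, hμ⟩ := hF.measurable_all
  have hset : MeasurableSet[F t] {ω | a t ω = b} :=
    hF.measurable_arm t t le_rfl (measurableSet_singleton b)
  have hg : Measurable fun ω => ENNReal.ofReal
      (Real.exp (if a t ω = b then lam * (y t ω - μ b ω) - lam ^ 2 / 4 else 0)) :=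
    (Real.measurable_exp.comp (Measurable.ite (hF.le t _ hset)
      ((((hy t).sub (hμ b hb)).const_mul _).sub_const _) measurable_const)).ennreal_ofReal
  have := lintegral_mul_le_of_setLIntegral_le (P := P) (hF.le t) hg (measurable_const (a := 1))
    (fun A hA => ?_) hW
  · simpa using this
  rw [← lintegral_inter_add_sdiff _ A (hF.le t _ hset),
    ← lintegral_inter_add_sdiff _ A (hF.le t _ hset)]
  refine add_le_add ?_ (le_of_eq ?_)
  · have hm := hF.le t _ (hA.inter hset)
    calc _ = ∫⁻ ω in A ∩ {ω | a t ω = b}, ENNReal.ofReal (Real.exp (-(lam ^ 2 / 4))) *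
          ENNReal.ofReal (Real.exp (lam * (y t ω - μ b ω))) ∂P := by
          refine setLIntegral_congr_fun hm fun ω hω => ?_
          have : a t ω = b := hω.2
          simp only [this, if_true]
          rw [← ENNReal.ofReal_mul (Real.exp_pos _).le, ← Real.exp_add]
          congr 2; ring
      _ ≤ ENNReal.ofReal (Real.exp (-(lam ^ 2 / 4))) *
          (ENNReal.ofReal (Real.exp (lam ^ 2 / 4)) * P (A ∩ {ω | a t ω = b})) := by
          rw [lintegral_const_mul' _ _ ENNReal.ofReal_ne_top]
          gcongr
          exact hF.subgaussian t ht b hb lam _ (hA.inter hset) fun ω hω => hω.2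
      _ = _ := by
          rw [← mul_assoc, ← ENNReal.ofReal_mul (Real.exp_pos _).le, ← Real.exp_add]
          simp
  · refine setLIntegral_congr_fun (hF.le t _ (hA.diff hset)) fun ω hω => ?_
    have : a t ω ≠ b := hω.2
    simp [this]

/-- The potential is a supermartingale started at `1 + 3 = 4`. It dominates the power `3/4` of the
running maximum; the maximum itself need not have a bounded mean, hence the exponent below `1`. -/
theorem IsFeedback.lintegral_doobPot_le [IsProbabilityMeasure P] (hF : IsFeedback P F K n a y μ)
    {b : ℕ} (hb : b < K) (lam : ℝ) (t : ℕ) (ht : t ≤ n) :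
    ∫⁻ ω, ENNReal.ofReal
      (doobPot (logSuper lam (fun s => a s ω) (fun s => y s ω) (μ b ω) b) t) ∂P ≤ 4 := by
  induction t with
  | zero =>
    simp only [doobPot, partialSups_zero, logSuper, noiseSum, playCount]
    norm_num
  | succ t ih =>
    refine le_trans ?_ (ih (by omega))
    set x : Ω → ℕ → ℝ := fun ω => logSuper lam (fun s => a s ω) (fun s => y s ω) (μ b ω) b with hx
    have hxm : ∀ s ≤ t, Measurable[F t] fun ω => x ω s := fun s hs =>
      measurable_logSuper lam b s (fun r hr => hF.measurable_arm t r (by omega))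
        (fun r hr => hF.measurable_reward t r (by omega)) (hF.measurable_mean t b hb)
    have hXm : Measurable[F t] fun ω => partialSups (x ω) t :=
      measurable_partialSups (x := fun s ω => x ω s) t hxm
    have hW : Measurable[F t] fun ω =>
        ENNReal.ofReal (3 * Real.exp (x ω t - partialSups (x ω) t / 4)) :=
      ((Real.measurable_exp.comp ((hxm t le_rfl).sub (hXm.div_const 4))).const_mul 3).ennreal_ofReal
    have hV : Measurable fun ω => ENNReal.ofReal (Real.exp (3 * partialSups (x ω) t / 4)) :=
      (Real.measurable_exp.comp (((hXm.mono (hF.le t) le_rfl).const_mul 3).div_const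
        4)).ennreal_ofReal
    calc ∫⁻ ω, ENNReal.ofReal (doobPot (x ω) (t + 1)) ∂P
        ≤ ∫⁻ ω, (ENNReal.ofReal (Real.exp (3 * partialSups (x ω) t / 4)) +
            ENNReal.ofReal (3 * Real.exp (x ω t - partialSups (x ω) t / 4)) *
            ENNReal.ofReal (Real.exp
              (if a t ω = b then lam * (y t ω - μ b ω) - lam ^ 2 / 4 else 0))) ∂P := by
          refine lintegral_mono fun ω => ?_
          rw [← ENNReal.ofReal_mul (by positivity), ← ENNReal.ofReal_add (by positivity)
            (by positivity)]
          refine ENNReal.ofReal_le_ofReal ((doobPot_succ_le _ _).trans (le_of_eq ?_))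
          rw [mul_assoc, ← Real.exp_add]
          simp only [hx, logSuper_succ]
          congr 3; ring
      _ ≤ ∫⁻ ω, ENNReal.ofReal (Real.exp (3 * partialSups (x ω) t / 4)) ∂P +
            ∫⁻ ω, ENNReal.ofReal (3 * Real.exp (x ω t - partialSups (x ω) t / 4)) ∂P := by
          rw [lintegral_add_left hV]
          exact add_le_add le_rfl (hF.lintegral_step hb (by omega) lam hW)
      _ = _ := by
          rw [← lintegral_add_left hV]
          refine lintegral_congr fun ω => ?_
          rw [← ENNReal.ofReal_add (by positivity) (by positivity)]
          rfl

/-- Maximal inequality: the exponentials `exp (θ S - θ² N / 3)` are dominated, simultaneously in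
time, by an integrable variable of expectation at most `4`. -/
theorem IsFeedback.exists_exp_le [IsProbabilityMeasure P] (hF : IsFeedback P F K n a y μ)
    {b : ℕ} (hb : b < K) (θ : ℝ) :
    ∃ Z : Ω → ℝ, (∀ ω, 0 ≤ Z ω) ∧ Integrable Z P ∧ ∫ ω, Z ω ∂P ≤ 4 ∧
      ∀ ω, ∀ t ≤ n, Real.exp (θ * noiseSum (fun s => a s ω) (fun s => y s ω) (μ b ω) b t -
        θ ^ 2 * playCount (fun s => a s ω) t b / 3) ≤ Z ω := by
  obtain ⟨ha, hy, hμ⟩ := hF.measurable_all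
  -- With parameter `4θ/3`, three quarters of the log-supermartingale is exactly `θ S - θ² N / 3`.
  set x : Ω → ℕ → ℝ := fun ω =>
    logSuper (4 * θ / 3) (fun s => a s ω) (fun s => y s ω) (μ b ω) b with hx
  have hXm : Measurable fun ω => partialSups (x ω) n :=
    measurable_partialSups (x := fun s ω => x ω s) n fun s _ =>
      measurable_logSuper _ b s (fun r _ => ha r) (fun r _ => hy r) (hμ b hb)
  have hZm : Measurable fun ω => Real.exp (3 * partialSups (x ω) n / 4) :=
    Real.measurable_exp.comp ((hXm.const_mul 3).div_const 4)
  have hlin : ∫⁻ ω, ENNReal.ofReal (Real.exp (3 * partialSups (x ω) n / 4)) ∂P ≤ 4 := by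
    refine le_trans (lintegral_mono fun ω => ?_) (hF.lintegral_doobPot_le hb (4 * θ / 3) n le_rfl)
    refine ENNReal.ofReal_le_ofReal ?_
    have := Real.exp_pos (x ω n - partialSups (x ω) n / 4)
    unfold doobPot
    linarith
  refine ⟨fun ω => Real.exp (3 * partialSups (x ω) n / 4), fun ω => (Real.exp_pos _).le, ?_, ?_,
    fun ω t ht => ?_⟩
  · refine ⟨hZm.aestronglyMeasurable, ?_⟩
    rw [hasFiniteIntegral_iff_ofReal (Filter.Eventually.of_forall fun ω => (Real.exp_pos _).le)]
    exact hlin.trans_lt (by norm_num)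
  · rw [integral_eq_lintegral_of_nonneg_ae (Filter.Eventually.of_forall fun ω =>
      (Real.exp_pos _).le) hZm.aestronglyMeasurable]
    exact ENNReal.toReal_le_of_le_ofReal (by norm_num) (by simpa using hlin)
  · refine Real.exp_le_exp.2 ?_
    have h1 : x ω t ≤ partialSups (x ω) n := le_partialSups_of_le (x ω) ht
    simp only [hx, logSuper] at h1
    linarith

end Medzo

/-! ### Deviation bounds that are linear in the maximal variables, and the series they produce. -/

namespace Medzo

/-- This replaces the integration of tail probabilities: an exponential moment bounds the deviation
itself. -/
theorem le_exp_div {s : ℝ} (hs : 0 < s) (u : ℝ) : u ≤ Real.exp (s * u - 1) / s := by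
  rw [le_div_iff₀ hs]
  have := Real.add_one_le_exp (s * u - 1)
  linarith

/-- Deviation below the mean, after many plays. -/
theorem dev_below_tail {δ N S Z : ℝ} (hδ : 0 < δ) (hN : 1 / 4 ≤ N * δ)
    (hZ : Real.exp (-(3 * √δ) * S - (-(3 * √δ)) ^ 2 * N / 3) ≤ Z) :
    -S / N - 2 * √δ ≤ √δ / 4 * Z := by
  have hr : 0 < √δ := Real.sqrt_pos.2 hδ
  have hr2 : √δ ^ 2 = δ := Real.sq_sqrt hδ.le
  have hN0 : 0 < N := by
    by_contra h
    have : N * δ ≤ 0 := mul_nonpos_of_nonpos_of_nonneg (not_lt.1 h) hδ.le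
    linarith
  have hs : 0 < 3 * √δ * N := by positivity
  have h1 := le_exp_div hs (-S / N - 2 * √δ)
  have e1 : 3 * √δ * N * (-S / N - 2 * √δ) - 1 =
      (-(3 * √δ) * S - (-(3 * √δ)) ^ 2 * N / 3) + (-3 * (N * δ) - 1) := by
    field_simp
    linear_combination (-3 * N) * hr2
  -- As `N δ ≥ 1/4`, the exponent is at most `-7/4`. No confidence width is needed in this range;
  -- the slack `2 √δ` suffices.
  have h3 : Real.exp (-3 * (N * δ) - 1) ≤ 3 / 16 := by
    have h4 : Real.exp (-3 * (N * δ) - 1) ≤ Real.exp (-(7 / 4)) := Real.exp_le_exp.2 (by linarith)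
    have h5 : (16 / 3 : ℝ) ≤ Real.exp (7 / 4) := by
      have : Real.exp (7 / 4) = Real.exp 1 * Real.exp (3 / 4) := by
        rw [← Real.exp_add]; norm_num
      rw [this]
      have h6 := Real.exp_one_gt_d9
      have h7 := Real.quadratic_le_exp_of_nonneg (x := 3 / 4) (by norm_num)
      nlinarith
    rw [Real.exp_neg] at h4
    refine h4.trans ?_
    rw [inv_le_comm₀ (by positivity) (by norm_num)]
    linarith
  have hZ0 : 0 ≤ Z := (Real.exp_pos _).le.trans hZ
  rw [e1, Real.exp_add] at h1
  refine h1.trans ?_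
  calc _ ≤ Z * (3 / 16) / (3 * √δ * N) := by gcongr
    _ ≤ √δ / 4 * Z := by
      rw [div_le_iff₀ hs]
      have : √δ / 4 * Z * (3 * √δ * N) = Z * (3 / 4) * (N * δ) := by
        linear_combination (3 / 4 * Z * N) * hr2
      rw [this]
      nlinarith

/-- The ratio of the series over dyadic blocks: it equals `2 ^ (-1/3)`, and `(5/4)³ < 2`. -/
theorem two_mul_exp_le : Real.exp (-(2 / 3) * Real.log 4) * 2 ≤ 4 / 5 := by
  have h2 : Real.log 4 = 2 * Real.log 2 := by
    rw [show (4 : ℝ) = 2 ^ 2 by norm_num, Real.log_pow]; norm_num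
  have h3 : Real.exp (-(2 / 3) * Real.log 4) * 2 = Real.exp (-(1 / 3) * Real.log 2) := by
    nth_rewrite 2 [← Real.exp_log (show (0 : ℝ) < 2 by norm_num)]
    rw [← Real.exp_add, h2]; congr 1; ring
  rw [h3, ← Real.exp_log (show (0 : ℝ) < 4 / 5 by norm_num)]
  refine Real.exp_le_exp.2 ?_
  have h5 : Real.log ((5 / 4) ^ 3) ≤ Real.log 2 := Real.log_le_log (by norm_num) (by norm_num)
  rw [Real.log_pow] at h5
  have h6 : Real.log (4 / 5) = - Real.log (5 / 4) := by
    rw [← Real.log_inv]; norm_num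
  rw [h6]
  push_cast at h5
  linarith

theorem one_le_log_four : 1 ≤ Real.log 4 := by
  have : Real.log 4 = 2 * Real.log 2 := by
    rw [show (4 : ℝ) = 2 ^ 2 by norm_num, Real.log_pow]; norm_num
  have := Real.log_two_gt_d9
  linarith

/-- Deviation below the mean for a number of plays in a dyadic block. -/
theorem dev_below_block {δ N S w Z : ℝ} {k : ℕ} (hδ : 0 < δ) (hN : 0 < N) (hk : 1 ≤ k)
    (h1 : (4 : ℝ) ^ k ≤ 1 / (N * δ)) (h2 : 1 / (N * δ) < (4 : ℝ) ^ (k + 1))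
    (hw : √(Real.log (1 / (N * δ)) / N) ≤ w)
    (hZ : Real.exp (-(√(k * Real.log 4) * 2 ^ (k + 1) * √δ) * S -
      (-(√(k * Real.log 4) * 2 ^ (k + 1) * √δ)) ^ 2 * N / 3) ≤ Z) :
    -S / N - w ≤ 3 / 4 * √δ * (4 / 5) ^ k * Z := by
  have hr : 0 < √δ := Real.sqrt_pos.2 hδ
  have hr2 : √δ ^ 2 = δ := Real.sq_sqrt hδ.le
  have hn : 0 < √N := Real.sqrt_pos.2 hN
  have hn2 : √N ^ 2 = N := Real.sq_sqrt hN.le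
  have hkR : (1 : ℝ) ≤ k := by exact_mod_cast hk
  set h := √(k * Real.log 4) with hh
  have hl := one_le_log_four
  have hh2 : h ^ 2 = k * Real.log 4 := Real.sq_sqrt (by positivity)
  have hh1 : 1 ≤ h := by
    rw [hh, Real.one_le_sqrt]; nlinarith
  -- The position of `N` inside its block, normalized to `1 ≤ z ≤ 2`. The tuning `θ = -h 2 ^ (k + 1)
  -- √δ` makes `θ² N = h² z²`.
  set z := 2 ^ (k + 1) * √δ * √N with hz
  have hz2 : z ^ 2 = (4 : ℝ) ^ (k + 1) * (N * δ) := by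
    rw [hz, mul_pow, mul_pow, hr2, hn2, ← pow_mul, mul_comm (k + 1) 2, pow_mul]
    norm_num; ring
  have hz0 : 0 < z := by positivity
  have hNδ : 0 < N * δ := by positivity
  have hz1 : 1 ≤ z := by
    rw [div_lt_iff₀ hNδ] at h2
    nlinarith
  have hz4 : z ≤ 2 := by
    rw [le_div_iff₀ hNδ] at h1
    rw [pow_succ (4 : ℝ) k] at hz2
    nlinarith
  have hθ : 0 < h * 2 ^ (k + 1) * √δ := by positivity
  have hwN : h * √N ≤ N * w := by
    have : h / √N ≤ w := by
      refine le_trans ?_ hw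
      rw [hh, ← Real.sqrt_div' _ hN.le]
      refine Real.sqrt_le_sqrt ?_
      gcongr
      rw [← Real.log_pow]
      exact Real.log_le_log (by positivity) h1
    rw [div_le_iff₀ hn] at this
    nlinarith
  have hs : 0 < h * 2 ^ (k + 1) * √δ * N := by positivity
  have h3 := le_exp_div hs (-S / N - w)
  have h4 : h * 2 ^ (k + 1) * √δ * N * (-S / N - w) - 1 ≤
      (-(h * 2 ^ (k + 1) * √δ) * S - (-(h * 2 ^ (k + 1) * √δ)) ^ 2 * N / 3) +
        (-(2 / 3) * h ^ 2 - 1) := by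
    have e1 : h * 2 ^ (k + 1) * √δ * N * (-S / N - w) =
        -(h * 2 ^ (k + 1) * √δ) * S - (h * 2 ^ (k + 1) * √δ) * (N * w) := by
      field_simp
    have e2 : (-(h * 2 ^ (k + 1) * √δ)) ^ 2 * N / 3 = h ^ 2 * z ^ 2 / 3 := by
      rw [← hn2, hz]; rw [hn2]; nth_rewrite 1 [← hn2]; ring
    have e3 : (h * 2 ^ (k + 1) * √δ) * (h * √N) = h ^ 2 * z := by rw [hz]; ring
    have e4 := mul_le_mul_of_nonneg_left hwN hθ.le
    rw [e1, e2]
    rw [e3] at e4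
    -- The exponent left over is `h² (z² / 3 - z)`, which is at most `-(2/3) h²` exactly when `1 ≤ z
    -- ≤ 2`.
    have e5 : 0 ≤ h ^ 2 * ((z - 1) * (2 - z)) :=
      mul_nonneg (by positivity) (mul_nonneg (by linarith) (by linarith))
    nlinarith
  have hZ0 : 0 ≤ Z := (Real.exp_pos _).le.trans hZ
  have h5 : Real.exp (-(2 / 3) * h ^ 2 - 1) ≤ Real.exp (-(2 / 3) * Real.log 4) ^ k * (3 / 8) := by
    rw [hh2, ← Real.exp_nat_mul, sub_eq_add_neg, Real.exp_add]
    have : Real.exp (-1) ≤ 3 / 8 := by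
      rw [Real.exp_neg, inv_le_comm₀ (by positivity) (by norm_num)]
      have := Real.exp_one_gt_d9
      linarith
    have e : -(2 / 3) * (k * Real.log 4) = k * (-(2 / 3) * Real.log 4) := by ring
    rw [e]
    gcongr
  have h6 : 1 ≤ 2 ^ (k + 1) * √δ * (h * 2 ^ (k + 1) * √δ * N) := by
    have : 2 ^ (k + 1) * √δ * (h * 2 ^ (k + 1) * √δ * N) = h * z ^ 2 := by
      rw [hz, mul_pow _ (√N), hn2]; ring
    rw [this]; nlinarith
  calc -S / N - w ≤ Z * (Real.exp (-(2 / 3) * Real.log 4) ^ k * (3 / 8)) /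
        (h * 2 ^ (k + 1) * √δ * N) := by
        refine h3.trans ?_
        gcongr
        refine (Real.exp_le_exp.2 h4).trans ?_
        rw [Real.exp_add]
        gcongr
    _ ≤ Z * (Real.exp (-(2 / 3) * Real.log 4) ^ k * (3 / 8)) * (2 ^ (k + 1) * √δ) := by
        rw [div_le_iff₀ hs, mul_assoc]
        exact le_mul_of_one_le_right (by positivity) h6
    _ = 3 / 4 * √δ * (Real.exp (-(2 / 3) * Real.log 4) * 2) ^ k * Z := by
        rw [mul_pow, pow_succ]; ring
    _ ≤ _ := by
        gcongr
        exact two_mul_exp_le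

/-- Deviation above the mean. -/
theorem dev_above {δ N S Z : ℝ} (hN : 0 < N)
    (hZ : Real.exp (1 / √N * S - (1 / √N) ^ 2 * N / 3) ≤ Z) :
    S / N - √δ ≤ 11 / 20 * (Real.exp (-√δ * √N) / √N) * Z := by
  have hn : 0 < √N := Real.sqrt_pos.2 hN
  have hn2 : √N ^ 2 = N := Real.sq_sqrt hN.le
  have h1 := le_exp_div hn (S / N - √δ)
  have e1 : √N * (S / N - √δ) - 1 =
      (1 / √N * S - (1 / √N) ^ 2 * N / 3) + (-√δ * √N + -(2 / 3)) := by
    nth_rewrite 2 [← hn2]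
    nth_rewrite 5 [← hn2]
    field_simp
    ring
  have hZ0 : 0 ≤ Z := (Real.exp_pos _).le.trans hZ
  have h3 : Real.exp (-(2 / 3)) ≤ 11 / 20 := by
    rw [Real.exp_neg, inv_le_comm₀ (by positivity) (by norm_num)]
    have h7 := Real.quadratic_le_exp_of_nonneg (x := 2 / 3) (by norm_num)
    linarith
  rw [e1, Real.exp_add, Real.exp_add] at h1
  refine h1.trans ?_
  calc _ ≤ Z * (Real.exp (-√δ * √N) * (11 / 20)) / √N := by gcongr
    _ = _ := by ring

/-- Comparison with the integral of `exp (-c √u) / √u`, whose primitive is `-(2 / c) exp (-c √u)`;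
the sum telescopes. -/
theorem sum_exp_neg_sqrt_le {c : ℝ} (hc : 0 < c) (n : ℕ) :
    ∑ j ∈ Finset.range n, Real.exp (-c * √((j + 1 : ℕ) : ℝ)) / √((j + 1 : ℕ) : ℝ) ≤ 2 / c := by
  suffices h : ∑ j ∈ Finset.range n, Real.exp (-c * √((j + 1 : ℕ) : ℝ)) / √((j + 1 : ℕ) : ℝ) ≤
      2 / c * (1 - Real.exp (-c * √(n : ℝ))) by
    refine h.trans ?_
    have := Real.exp_pos (-c * √(n : ℝ))
    have h2 : 0 < 2 / c := by positivity
    nlinarith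
  induction n with
  | zero => simp
  | succ n ih =>
    rw [Finset.sum_range_succ]
    set q := √((n + 1 : ℕ) : ℝ) with hq
    set r := √(n : ℝ) with hr
    have hq0 : 0 < q := Real.sqrt_pos.2 (by positivity)
    have hr0 : 0 ≤ r := Real.sqrt_nonneg _
    have hqr : q ^ 2 - r ^ 2 = 1 := by
      rw [hq, hr, Real.sq_sqrt (by positivity), Real.sq_sqrt (by positivity)]; push_cast; ring
    have hle : r ≤ q := Real.sqrt_le_sqrt (by push_cast; linarith)
    have h1 : 1 ≤ 2 * q * (q - r) := by nlinarith
    have h2 : Real.exp (-c * q) * (c * (q - r)) ≤ Real.exp (-c * r) - Real.exp (-c * q) := by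
      have : Real.exp (-c * r) = Real.exp (-c * q) * Real.exp (c * (q - r)) := by
        rw [← Real.exp_add]; congr 1; ring
      rw [this]
      have h3 := Real.add_one_le_exp (c * (q - r))
      nlinarith [Real.exp_pos (-c * q)]
    have h4 : Real.exp (-c * q) / q ≤ 2 / c * (Real.exp (-c * r) - Real.exp (-c * q)) := by
      rw [div_le_iff₀ hq0]
      calc Real.exp (-c * q) ≤ Real.exp (-c * q) * (2 * q * (q - r)) :=
            le_mul_of_one_le_right (Real.exp_pos _).le h1
        _ = 2 / c * (Real.exp (-c * q) * (c * (q - r))) * q := by field_simp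
        _ ≤ _ := by gcongr
    linarith

/-- The width of the confidence interval of MOSS after `j` plays. -/
noncomputable def mossWidth (K H j : ℕ) : ℝ := √(Real.posLog ((H : ℝ) / ((K : ℝ) * j)) / j)

theorem sum_mossWidth_le {K H : ℕ} (hK : 0 < K) (hH : 0 < H) (n : ℕ) :
    ∑ j ∈ Finset.range n, mossWidth K H (j + 1) ≤ 17 / 3 / √((K : ℝ) / H) := by
  set δ : ℝ := (K : ℝ) / H with hδ
  have hδ0 : 0 < δ := by positivity
  have hr : 0 < √δ := Real.sqrt_pos.2 hδ0
  have hr2 : √δ ^ 2 = δ := Real.sq_sqrt hδ0.le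
  -- From `log (1 / u) ≤ 2 / √u`, each width is of order `δ ^ (-1/4) j ^ (-3/4)`, so the sum
  -- telescopes against `(δ n) ^ (1/4)`, capped where the width vanishes. The constant comes from
  -- `(17/3)² ≥ 2 · 4²`.
  suffices h : ∑ j ∈ Finset.range n, mossWidth K H (j + 1) ≤
      17 / 3 / √δ * √√(min (δ * n) 1) by
    refine h.trans (mul_le_of_le_one_right (by positivity) ?_)
    refine Real.sqrt_le_iff.2 ⟨zero_le_one, Real.sqrt_le_iff.2 ⟨by positivity, ?_⟩⟩
    norm_num
  induction n with
  | zero => simp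
  | succ n ih =>
    rw [Finset.sum_range_succ]
    suffices h : mossWidth K H (n + 1) ≤
        17 / 3 / √δ * (√√(min (δ * (n + 1 : ℕ)) 1) - √√(min (δ * n) 1)) by linarith
    have harg : (H : ℝ) / (K * (n + 1 : ℕ)) = 1 / (δ * (n + 1 : ℕ)) := by
      rw [hδ]; field_simp
    unfold mossWidth
    rw [harg]
    rcases le_total 1 (δ * (n + 1 : ℕ)) with h1 | h1
    · have h0 : Real.posLog (1 / (δ * (n + 1 : ℕ))) = 0 := by
        rw [Real.posLog_eq_zero_iff, abs_of_nonneg (by positivity)]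
        rw [div_le_one (by positivity)]
        exact h1
      rw [h0, zero_div, Real.sqrt_zero]
      refine mul_nonneg (by positivity) (sub_nonneg.2 ?_)
      refine Real.sqrt_le_sqrt (Real.sqrt_le_sqrt (min_le_min ?_ le_rfl))
      push_cast
      nlinarith
    · have h2 : δ * n ≤ 1 := by push_cast at h1; nlinarith
      rw [min_eq_left h1, min_eq_left h2]
      set q := √√(δ * (n + 1 : ℕ)) with hq
      set r := √√(δ * n) with hr'
      have hpos : 0 < δ * (n + 1 : ℕ) := by positivity
      have hq0 : 0 < q := Real.sqrt_pos.2 (Real.sqrt_pos.2 hpos)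
      have hq2 : q ^ 2 = √(δ * (n + 1 : ℕ)) := Real.sq_sqrt (Real.sqrt_nonneg _)
      have hq4 : q ^ 4 = δ * (n + 1 : ℕ) := by
        rw [show 4 = 2 * 2 by norm_num, pow_mul, hq2, Real.sq_sqrt hpos.le]
      have hr4 : r ^ 4 = δ * n := by
        rw [show 4 = 2 * 2 by norm_num, pow_mul, hr', Real.sq_sqrt (Real.sqrt_nonneg _),
          Real.sq_sqrt (by positivity)]
      have hr0 : 0 ≤ r := Real.sqrt_nonneg _
      have hle : r ≤ q := by
        refine Real.sqrt_le_sqrt (Real.sqrt_le_sqrt ?_)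
        push_cast
        nlinarith
      have hd : δ ≤ (q - r) * (4 * q ^ 3) := by
        have e1 : δ = (q - r) * ((q + r) * (q ^ 2 + r ^ 2)) := by
          have : δ = q ^ 4 - r ^ 4 := by rw [hq4, hr4]; push_cast; ring
          rw [this]; ring
        have e2 : (q + r) * (q ^ 2 + r ^ 2) ≤ (q + q) * (q ^ 2 + q ^ 2) := by gcongr
        calc δ = (q - r) * ((q + r) * (q ^ 2 + r ^ 2)) := e1
          _ ≤ (q - r) * ((q + q) * (q ^ 2 + q ^ 2)) :=
            mul_le_mul_of_nonneg_left e2 (by linarith)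
          _ = _ := by ring
      have hlog : Real.posLog (1 / (δ * (n + 1 : ℕ))) ≤ 2 / q ^ 2 := by
        rw [Real.posLog, ← hq4]
        refine max_le (by positivity) ?_
        have : (1 : ℝ) / q ^ 4 = (1 / q ^ 2) ^ 2 := by field_simp
        rw [this, Real.log_pow]
        have h3 := Real.log_le_sub_one_of_pos (x := 1 / q ^ 2) (by positivity)
        push_cast
        rw [show 2 / q ^ 2 = 2 * (1 / q ^ 2) by ring]
        linarith
      have hn : ((n + 1 : ℕ) : ℝ) = q ^ 4 / δ := by rw [hq4]; field_simp
      refine Real.sqrt_le_iff.2 ⟨mul_nonneg (by positivity) (by linarith), ?_⟩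
      calc Real.posLog (1 / (δ * (n + 1 : ℕ))) / (n + 1 : ℕ)
          ≤ 2 / q ^ 2 / (n + 1 : ℕ) := by gcongr
        _ = 2 * δ / q ^ 6 := by rw [hn]; field_simp
        _ ≤ (17 / 3) ^ 2 * (q - r) ^ 2 / δ := by
            rw [div_le_div_iff₀ (by positivity) hδ0]
            have : δ ^ 2 ≤ ((q - r) * (4 * q ^ 3)) ^ 2 := by gcongr
            have h5 : 0 ≤ (q - r) ^ 2 * q ^ 6 := by positivity
            nlinarith
        _ = _ := by rw [mul_pow, div_pow _ (√δ), hr2]; ring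

end Medzo

/-! ### The regret of MOSS. -/

namespace Medzo

theorem playCount_le (a : ℕ → ℕ) (t b : ℕ) : playCount a t b ≤ t :=
  (Finset.card_filter_le _ _).trans (by simp)

theorem playCount_mono (a : ℕ → ℕ) (b : ℕ) : Monotone fun t => playCount a t b :=
  monotone_nat_of_le_succ fun t => by simp [playCount_succ]

/-- Each play of an arm raises its count. This lets the upward deviation of an arm be charged once
per count, with `θ` adapted to that count. -/
theorem playCount_pair_injective (a : ℕ → ℕ) :
    Function.Injective fun t => (a t, playCount a t (a t)) := by
  have key : ∀ s t, s < t → (a s, playCount a s (a s)) ≠ (a t, playCount a t (a t)) := by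
    intro s t hst h
    obtain ⟨h1, h2⟩ := Prod.mk.inj h
    have h3 := playCount_mono a (a s) (Nat.succ_le_of_lt hst)
    simp only [Nat.succ_eq_add_one, playCount_succ] at h3
    rw [← h1] at h2
    simp at h3
    omega
  intro s t h
  rcases lt_trichotomy s t with hst | hst | hst
  · exact absurd h (key s t hst)
  · exact hst
  · exact absurd h.symm (key t s hst)

/-- Each pair (arm, number of plays) occurs at most once. -/
theorem sum_playCount_le {a : ℕ → ℕ} {K n : ℕ} (ha : ∀ t < n, a t < K) {g : ℕ → ℕ → ℝ}
    (hg : ∀ b j, 0 ≤ g b j) :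
    ∑ t ∈ Finset.range n, g (a t) (playCount a t (a t)) ≤
      ∑ b ∈ Finset.range K, (g b 0 + ∑ j ∈ Finset.range n, g b (j + 1)) := by
  have h1 : ∑ t ∈ Finset.range n, g (a t) (playCount a t (a t)) =
      ∑ q ∈ (Finset.range n).image fun t => (a t, playCount a t (a t)), g q.1 q.2 :=
    (Finset.sum_image (f := fun q : ℕ × ℕ => g q.1 q.2)
      ((playCount_pair_injective a).injOn)).symm
  have h2 : ∑ b ∈ Finset.range K, (g b 0 + ∑ j ∈ Finset.range n, g b (j + 1)) =
      ∑ q ∈ Finset.range K ×ˢ Finset.range (n + 1), g q.1 q.2 := by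
    rw [Finset.sum_product]
    refine Finset.sum_congr rfl fun b _ => ?_
    rw [Finset.sum_range_succ', add_comm]
  rw [h1, h2]
  refine Finset.sum_le_sum_of_subset_of_nonneg ?_ fun q _ _ => hg _ _
  intro q hq
  obtain ⟨t, ht, rfl⟩ := Finset.mem_image.1 hq
  rw [Finset.mem_range] at ht
  have := playCount_le a t (a t)
  simp only [Finset.mem_product, Finset.mem_range]
  exact ⟨ha t ht, by omega⟩

theorem mossIndex_eq {K H : ℕ} {a : ℕ → ℕ} {y : ℕ → ℝ} {t b : ℕ} (μ : ℝ)
    (h : playCount a t b ≠ 0) :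
    mossIndex K H a y t b = ((μ + (noiseSum a y μ b t / playCount a t b +
      mossWidth K H (playCount a t b)) : ℝ) : EReal) := by
  rw [mossIndex, if_neg h, noiseSum_eq a y μ b t h, mossWidth]
  congr 1; ring

/-- Lower bound on the index of an arm, in terms of the maximal variables `Z`. -/
theorem dev_below {K H N : ℕ} {S : ℝ} {Z : ℕ → ℝ} (hK : 0 < K) (hH : 0 < H) (hN : 0 < N)
    (hZ0 : ∀ k, 0 ≤ Z k)
    (hZtail : Real.exp (-(3 * √((K : ℝ) / H)) * S - (-(3 * √((K : ℝ) / H))) ^ 2 * N / 3) ≤ Z 0)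
    (hZ : ∀ k : ℕ, 1 ≤ k → Real.exp (-(√(k * Real.log 4) * 2 ^ (k + 1) * √((K : ℝ) / H)) * S -
      (-(√(k * Real.log 4) * 2 ^ (k + 1) * √((K : ℝ) / H))) ^ 2 * N / 3) ≤ Z k) :
    -S / N - mossWidth K H N ≤ 2 * √((K : ℝ) / H) + √((K : ℝ) / H) / 4 * Z 0 +
      ∑ k ∈ Finset.range H, 3 / 4 * √((K : ℝ) / H) * (4 / 5) ^ (k + 1) * Z (k + 1) := by
  set δ : ℝ := (K : ℝ) / H with hδ
  have hδ0 : 0 < δ := by positivity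
  have hNR : (0 : ℝ) < N := by exact_mod_cast hN
  have hw0 : 0 ≤ mossWidth K H N := Real.sqrt_nonneg _
  have hterm : ∀ k, 0 ≤ 3 / 4 * √δ * (4 / 5) ^ (k + 1) * Z (k + 1) := fun k =>
    mul_nonneg (by positivity) (hZ0 _)
  have hsum := Finset.sum_nonneg fun k (_ : k ∈ Finset.range H) => hterm k
  rcases le_or_gt (1 / 4) (N * δ) with h | h
  · have := dev_below_tail hδ0 h hZtail
    linarith
  · have hNδ : 0 < N * δ := by positivity
    obtain ⟨k, hk1, hk2⟩ := exists_nat_pow_near (x := 1 / (N * δ)) (y := 4)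
      (by rw [le_div_iff₀ hNδ]; linarith) (by norm_num)
    have hk : 1 ≤ k := by
      by_contra hk
      have : k = 0 := by omega
      subst this
      rw [div_lt_iff₀ hNδ, zero_add, pow_one] at hk2
      linarith
    -- Since `1 / (N δ) = H / (K N) ≤ H`, only blocks with `4 ^ k ≤ H` occur, so a finite sum covers
    -- them all.
    have hkH : k ≤ H := by
      have h3 : (1 : ℝ) / (N * δ) ≤ H := by
        rw [hδ, div_le_iff₀ (by positivity)]
        have : (H : ℝ) * (N * (K / H)) = N * K := by field_simp
        rw [this]
        exact_mod_cast Nat.mul_pos hN hK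
      have h4 : (4 : ℕ) ^ k ≤ H := by exact_mod_cast hk1.trans h3
      exact (Nat.lt_pow_self (by norm_num)).le.trans h4
    have hw : √(Real.log (1 / (N * δ)) / N) ≤ mossWidth K H N := by
      refine Real.sqrt_le_sqrt ?_
      gcongr
      have : (H : ℝ) / (K * N) = 1 / (N * δ) := by rw [hδ]; field_simp
      rw [this]
      exact le_max_right _ _
    have h5 := dev_below_block hδ0 hNR hk hk1 hk2 hw (hZ k hk)
    have h6 := Finset.single_le_sum (fun k (_ : k ∈ Finset.range H) => hterm k)
      (Finset.mem_range.2 (show k - 1 < H by omega))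
    rw [Nat.sub_add_cancel hk] at h6
    have h7 : 0 ≤ √δ / 4 * Z 0 := mul_nonneg (by positivity) (hZ0 0)
    have h8 : 0 ≤ √δ := Real.sqrt_nonneg _
    linarith

/-- Pathwise bound on the regret of MOSS with respect to the arm `c`. -/
theorem moss_regret_pathwise {K H n c : ℕ} {a : ℕ → ℕ} {y μ : ℕ → ℝ} {Z : ℕ → ℝ}
    {V : ℕ → ℕ → ℝ} (hK : 0 < K) (hH : 0 < H) (hc : c < K)
    (hchoice : ∀ t < n, IsMossChoice K H a y t) (hμ : ∀ b < K, μ b ∈ Set.Icc (0 : ℝ) 1)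
    (hZ0 : ∀ k, 0 ≤ Z k) (hV0 : ∀ b j, 0 ≤ V b j)
    (hZtail : ∀ t ≤ n, Real.exp (-(3 * √((K : ℝ) / H)) * noiseSum a y (μ c) c t -
      (-(3 * √((K : ℝ) / H))) ^ 2 * playCount a t c / 3) ≤ Z 0)
    (hZ : ∀ k : ℕ, 1 ≤ k → ∀ t ≤ n,
      Real.exp (-(√(k * Real.log 4) * 2 ^ (k + 1) * √((K : ℝ) / H)) * noiseSum a y (μ c) c t -
      (-(√(k * Real.log 4) * 2 ^ (k + 1) * √((K : ℝ) / H))) ^ 2 * playCount a t c / 3) ≤ Z k)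
    (hV : ∀ b < K, ∀ j : ℕ, ∀ t ≤ n, Real.exp (1 / √(j : ℝ) * noiseSum a y (μ b) b t -
      (1 / √(j : ℝ)) ^ 2 * playCount a t b / 3) ≤ V b j) :
    ∑ t ∈ Finset.range n, (μ c - μ (a t)) ≤
      n * (3 * √((K : ℝ) / H) + √((K : ℝ) / H) / 4 * Z 0 +
        ∑ k ∈ Finset.range H, 3 / 4 * √((K : ℝ) / H) * (4 / 5) ^ (k + 1) * Z (k + 1)) +
      ∑ b ∈ Finset.range K, (1 + ∑ j ∈ Finset.range n, (mossWidth K H (j + 1) +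
        11 / 20 * (Real.exp (-√((K : ℝ) / H) * √((j + 1 : ℕ) : ℝ)) / √((j + 1 : ℕ) : ℝ)) *
          V b (j + 1))) := by
  set r := √((K : ℝ) / H) with hr
  have hr0 : 0 ≤ r := Real.sqrt_nonneg _
  set D := 2 * r + r / 4 * Z 0 +
      ∑ k ∈ Finset.range H, 3 / 4 * r * (4 / 5) ^ (k + 1) * Z (k + 1) with hD
  have hD0 : 0 ≤ D := add_nonneg (add_nonneg (by positivity) (mul_nonneg (by positivity) (hZ0 0)))
    (Finset.sum_nonneg fun k _ => mul_nonneg (by positivity) (hZ0 _))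
  set g : ℕ → ℕ → ℝ := fun b j => if j = 0 then 1 else mossWidth K H j +
    11 / 20 * (Real.exp (-r * √(j : ℝ)) / √(j : ℝ)) * V b j with hg
  have hg0 : ∀ b j, 0 ≤ g b j := by
    intro b j
    simp only [hg]
    split_ifs
    · exact zero_le_one
    · exact add_nonneg (Real.sqrt_nonneg _) (mul_nonneg (by positivity) (hV0 b j))
  -- Comparing indices, the gap is at most (shortfall of `c` below its mean minus its width) plus
  -- (excess of the chosen arm plus its width). The first is controlled by `D`; the second costs `r`
  -- plus a term in `g`. A first play costs at most `1`.
  have hround : ∀ t ∈ Finset.range n,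
      μ c - μ (a t) ≤ (D + r) + g (a t) (playCount a t (a t)) := by
    intro t ht
    rw [Finset.mem_range] at ht
    obtain ⟨haK, hmax⟩ := hchoice t ht
    by_cases h0 : playCount a t (a t) = 0
    · have h1 := (hμ c hc).2
      have h2 := (hμ _ haK).1
      have h3 : g (a t) (playCount a t (a t)) = 1 := by simp only [hg, h0, if_true]
      rw [h3]
      linarith
    · have hle := hmax c hc
      rw [mossIndex_eq (μ (a t)) h0] at hle
      -- An unplayed `c` would have infinite index and beat the finite index of the chosen arm.
      have hc0 : playCount a t c ≠ 0 := by
        intro h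
        rw [mossIndex, if_pos h, top_le_iff] at hle
        exact EReal.coe_ne_top _ hle
      rw [mossIndex_eq (μ c) hc0, EReal.coe_le_coe_iff] at hle
      have h1 := dev_below hK hH (Nat.pos_of_ne_zero hc0) hZ0 (hZtail t ht.le)
        (fun k hk => hZ k hk t ht.le)
      have h2 := dev_above (δ := (K : ℝ) / H) (by exact_mod_cast Nat.pos_of_ne_zero h0)
        (hV (a t) haK (playCount a t (a t)) t ht.le)
      rw [← hr] at h1 h2
      have h3 : g (a t) (playCount a t (a t)) = mossWidth K H (playCount a t (a t)) +
          11 / 20 * (Real.exp (-r * √(playCount a t (a t) : ℝ)) / √(playCount a t (a t) : ℝ)) *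
            V (a t) (playCount a t (a t)) := by simp only [hg, h0, if_false]
      rw [h3]
      rw [neg_div] at h1
      linarith
  calc ∑ t ∈ Finset.range n, (μ c - μ (a t))
      ≤ ∑ t ∈ Finset.range n, ((D + r) + g (a t) (playCount a t (a t))) := Finset.sum_le_sum hround
    _ ≤ n * (D + r) + ∑ b ∈ Finset.range K, (g b 0 + ∑ j ∈ Finset.range n, g b (j + 1)) := by
        rw [Finset.sum_add_distrib, Finset.sum_const, Finset.card_range, nsmul_eq_mul]
        gcongr
        exact sum_playCount_le (fun t ht => (hchoice t ht).1) hg0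
    _ = _ := by
        congr 1
        · rw [hD]; ring

theorem sum_four_fifths_le (n : ℕ) : ∑ k ∈ Finset.range n, ((4 : ℝ) / 5) ^ (k + 1) ≤ 4 := by
  suffices h : ∑ k ∈ Finset.range n, ((4 : ℝ) / 5) ^ (k + 1) = 4 - 4 * (4 / 5) ^ n by
    rw [h]
    have : (0 : ℝ) ≤ (4 / 5) ^ n := by positivity
    linarith
  induction n with
  | zero => simp
  | succ n ih => rw [Finset.sum_range_succ, ih]; ring

variable {Ω : Type*} [m0 : MeasurableSpace Ω] {P : Measure Ω} {F : ℕ → MeasurableSpace Ω}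
  {K n : ℕ} {a : ℕ → Ω → ℕ} {y : ℕ → Ω → ℝ} {μ : ℕ → Ω → ℝ}

/-- Distribution-free regret bound for MOSS with `1/2`-subgaussian noise, with respect to any
arm `c`. -/
theorem moss_regret_le [IsProbabilityMeasure P] (hF : IsFeedback P F K n a y μ) {H c : ℕ}
    (hKH : K ≤ H) (hn : n ≤ H) (hc : c < K)
    (hchoice : ∀ t < n, ∀ᵐ ω ∂P, IsMossChoice K H (fun s => a s ω) (fun s => y s ω) t)
    (hμ : ∀ ω, ∀ b < K, μ b ω ∈ Set.Icc (0 : ℝ) 1)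
    (hint : Integrable (fun ω => ∑ t ∈ Finset.range n, (μ c ω - μ (a t ω) ω)) P) :
    ∫ ω, ∑ t ∈ Finset.range n, (μ c ω - μ (a t ω) ω) ∂P ≤ 29 * √((K : ℝ) * H) := by
  have hK : 0 < K := by omega
  have hH : 0 < H := by omega
  set r := √((K : ℝ) / H) with hr
  have hr0 : 0 < r := Real.sqrt_pos.2 (by positivity)
  choose! Z hZ0 hZi hZ4 hZ using fun θ : ℝ => hF.exists_exp_le hc θ
  have hV' : ∀ b j : ℕ, ∃ V : Ω → ℝ, (∀ ω, 0 ≤ V ω) ∧ Integrable V P ∧ ∫ ω, V ω ∂P ≤ 4 ∧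
      (b < K → ∀ ω, ∀ t ≤ n, Real.exp (1 / √(j : ℝ) *
        noiseSum (fun s => a s ω) (fun s => y s ω) (μ b ω) b t -
        (1 / √(j : ℝ)) ^ 2 * playCount (fun s => a s ω) t b / 3) ≤ V ω) := by
    intro b j
    by_cases hb : b < K
    · obtain ⟨V, h1, h2, h3, h4⟩ := hF.exists_exp_le hb (1 / √(j : ℝ))
      exact ⟨V, h1, h2, h3, fun _ => h4⟩
    · exact ⟨0, fun _ => le_rfl, integrable_zero _ _ _, by simp, fun h => absurd h hb⟩
  choose V hV0 hVi hV4 hV using hV'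
  set ζ : ℕ → Ω → ℝ := fun k =>
    if k = 0 then Z (-(3 * r)) else Z (-(√(k * Real.log 4) * 2 ^ (k + 1) * r)) with hζ
  have hζ0 : ∀ k ω, 0 ≤ ζ k ω := by
    intro k ω; simp only [hζ]; split_ifs <;> exact hZ0 _ ω
  have hζi : ∀ k, Integrable (ζ k) P := by
    intro k; simp only [hζ]; split_ifs <;> exact hZi _
  have hζ4 : ∀ k, ∫ ω, ζ k ω ∂P ≤ 4 := by
    intro k; simp only [hζ]; split_ifs <;> exact hZ4 _
  have hpath : ∀ᵐ ω ∂P, ∑ t ∈ Finset.range n, (μ c ω - μ (a t ω) ω) ≤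
      n * (3 * r + r / 4 * ζ 0 ω +
        ∑ k ∈ Finset.range H, 3 / 4 * r * (4 / 5) ^ (k + 1) * ζ (k + 1) ω) +
      ∑ b ∈ Finset.range K, (1 + ∑ j ∈ Finset.range n, (mossWidth K H (j + 1) +
        11 / 20 * (Real.exp (-r * √((j + 1 : ℕ) : ℝ)) / √((j + 1 : ℕ) : ℝ)) *
          V b (j + 1) ω)) := by
    have hall : ∀ᵐ ω ∂P, ∀ t < n, IsMossChoice K H (fun s => a s ω) (fun s => y s ω) t := by
      rw [ae_all_iff]; intro t
      rw [Filter.eventually_imp_distrib_left]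
      exact hchoice t
    filter_upwards [hall] with ω hω
    refine moss_regret_pathwise (a := fun s => a s ω) (y := fun s => y s ω) (μ := fun b => μ b ω)
      (Z := fun k => ζ k ω) (V := fun b j => V b j ω) hK hH hc hω (hμ ω) (fun k => hζ0 k ω)
      (fun b j => hV0 b j ω) ?_ ?_ fun b hb j => hV b j hb ω
    · intro t ht
      simp only [hζ, if_true]
      exact hZ _ ω t ht
    · intro k hk t ht
      simp only [hζ, if_neg (show k ≠ 0 by omega)]
      exact hZ _ ω t ht
  have hi1 : Integrable (fun ω => 3 * r + r / 4 * ζ 0 ω) P :=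
    (integrable_const _).add ((hζi 0).const_mul _)
  have hi2 : ∀ k ∈ Finset.range H,
      Integrable (fun ω => 3 / 4 * r * (4 / 5) ^ (k + 1) * ζ (k + 1) ω) P :=
    fun k _ => (hζi _).const_mul _
  have hi3 : ∀ b, ∀ j ∈ Finset.range n, Integrable (fun ω => mossWidth K H (j + 1) +
        11 / 20 * (Real.exp (-r * √((j + 1 : ℕ) : ℝ)) / √((j + 1 : ℕ) : ℝ)) * V b (j + 1) ω) P :=
    fun b j _ => (integrable_const _).add ((hVi _ _).const_mul _)
  have hi4 : ∀ b ∈ Finset.range K, Integrable (fun ω => 1 + ∑ j ∈ Finset.range n,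
      (mossWidth K H (j + 1) + 11 / 20 * (Real.exp (-r * √((j + 1 : ℕ) : ℝ)) /
        √((j + 1 : ℕ) : ℝ)) * V b (j + 1) ω)) P :=
    fun b _ => (integrable_const _).add (integrable_finsetSum _ (hi3 b))
  have hi5 : Integrable (fun ω => n * (3 * r + r / 4 * ζ 0 ω +
        ∑ k ∈ Finset.range H, 3 / 4 * r * (4 / 5) ^ (k + 1) * ζ (k + 1) ω)) P :=
    (hi1.add (integrable_finsetSum _ hi2)).const_mul _
  refine (integral_mono_ae hint (hi5.add (integrable_finsetSum _ hi4)) hpath).trans ?_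
  simp only [Pi.add_apply]
  rw [integral_add hi5 (integrable_finsetSum _ hi4), integral_const_mul,
    integral_add hi1 (integrable_finsetSum _ hi2), integral_finsetSum _ hi2,
    integral_finsetSum _ hi4]
  have e1 : ∫ ω, (3 * r + r / 4 * ζ 0 ω) ∂P ≤ 4 * r := by
    rw [integral_add (integrable_const _) ((hζi 0).const_mul _), integral_const_mul (r / 4)]
    have := mul_le_mul_of_nonneg_left (hζ4 0) (show 0 ≤ r / 4 by positivity)
    simp only [integral_const, probReal_univ, one_smul]
    linarith
  have e2 : ∑ k ∈ Finset.range H, ∫ ω, 3 / 4 * r * (4 / 5) ^ (k + 1) * ζ (k + 1) ω ∂P ≤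
      12 * r := by
    calc _ ≤ ∑ k ∈ Finset.range H, 3 * r * (4 / 5) ^ (k + 1) := by
          refine Finset.sum_le_sum fun k _ => ?_
          rw [integral_const_mul]
          have := mul_le_mul_of_nonneg_left (hζ4 (k + 1))
            (show 0 ≤ 3 / 4 * r * (4 / 5) ^ (k + 1) by positivity)
          linarith
      _ ≤ 12 * r := by
          rw [← Finset.mul_sum]
          have := mul_le_mul_of_nonneg_left (sum_four_fifths_le H) (show 0 ≤ 3 * r by positivity)
          linarith
  have e3 : ∀ b ∈ Finset.range K, ∫ ω, (1 + ∑ j ∈ Finset.range n,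
      (mossWidth K H (j + 1) + 11 / 20 * (Real.exp (-r * √((j + 1 : ℕ) : ℝ)) /
        √((j + 1 : ℕ) : ℝ)) * V b (j + 1) ω)) ∂P ≤ 1 + (17 / 3 / r + 22 / 5 / r) := by
    intro b hb
    rw [integral_add (integrable_const _) (integrable_finsetSum _ (hi3 b)),
      integral_finsetSum _ (hi3 b)]
    simp only [integral_const, probReal_univ, one_smul]
    gcongr
    calc _ ≤ ∑ j ∈ Finset.range n, (mossWidth K H (j + 1) + 11 / 5 *
          (Real.exp (-r * √((j + 1 : ℕ) : ℝ)) / √((j + 1 : ℕ) : ℝ))) := by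
          refine Finset.sum_le_sum fun j _ => ?_
          rw [integral_add (integrable_const _) ((hVi _ _).const_mul _),
            integral_const_mul
              (11 / 20 * (Real.exp (-r * √((j + 1 : ℕ) : ℝ)) / √((j + 1 : ℕ) : ℝ)))]
          simp only [integral_const, probReal_univ, one_smul]
          have := mul_le_mul_of_nonneg_left (hV4 b (j + 1))
            (show 0 ≤ 11 / 20 * (Real.exp (-r * √((j + 1 : ℕ) : ℝ)) / √((j + 1 : ℕ) : ℝ)) by
              positivity)
          linarith
      _ ≤ _ := by
          rw [Finset.sum_add_distrib, ← Finset.mul_sum]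
          have h1 := sum_mossWidth_le hK hH n
          have h2 := sum_exp_neg_sqrt_le hr0 n
          have h3 := mul_le_mul_of_nonneg_left h2 (show (0 : ℝ) ≤ 11 / 5 by norm_num)
          have h4 : 11 / 5 * (2 / r) = 22 / 5 / r := by ring
          rw [h4] at h3
          exact add_le_add h1 h3
  have e4 := Finset.sum_le_sum e3
  rw [Finset.sum_const, Finset.card_range, nsmul_eq_mul] at e4
  have hKR : (0 : ℝ) < K := by exact_mod_cast hK
  have hHR : (0 : ℝ) < H := by exact_mod_cast hH
  have hnR : (n : ℝ) ≤ H := by exact_mod_cast hn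
  have hKHR : (K : ℝ) ≤ H := by exact_mod_cast hKH
  set R := √((K : ℝ) * H) with hR
  have hHr : H * r = R := by
    rw [hR, hr, ← Real.sqrt_sq hHR.le, ← Real.sqrt_mul (by positivity), Real.sqrt_sq hHR.le]
    congr 1; field_simp
  have hKr : K / r = R := by
    rw [div_eq_iff hr0.ne', hR, hr, ← Real.sqrt_mul (by positivity)]
    have : (K : ℝ) * H * (K / H) = K ^ 2 := by field_simp
    rw [this, Real.sqrt_sq hKR.le]
  have hKR' : (K : ℝ) ≤ R := Real.le_sqrt_of_sq_le (by nlinarith)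
  have hnr : n * r ≤ R := by rw [← hHr]; gcongr
  have e5 : (n : ℝ) * (∫ ω, (3 * r + r / 4 * ζ 0 ω) ∂P +
      ∑ k ∈ Finset.range H, ∫ ω, 3 / 4 * r * (4 / 5) ^ (k + 1) * ζ (k + 1) ω ∂P) ≤ 16 * R := by
    calc _ ≤ (n : ℝ) * (16 * r) := by gcongr; linarith
      _ ≤ _ := by linarith
  -- With `K ≤ R`, the total is at most `(16 + 1 + 151/15) R`, below `29 R`.
  have e6 : (K : ℝ) * (1 + (17 / 3 / r + 22 / 5 / r)) = K + 151 / 15 * (K / r) := by ring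
  rw [e6, hKr] at e4
  linarith

end Medzo

/-! ### One regime of MeDZO as a finite-armed bandit. -/

namespace Medzo

theorem regimeStart_succ {p i : ℕ} (hi : 1 ≤ i) :
    regimeStart p (i + 1) = regimeStart p i + regimeLength p i := by
  unfold regimeStart
  rw [Finset.sum_Ico_succ_top hi]

theorem regimeStart_mono (p : ℕ) : Monotone (regimeStart p) := fun _ _ h =>
  Finset.sum_le_sum_of_subset (Finset.Ico_subset_Ico le_rfl h)

theorem regimeStart_add (p i : ℕ) : regimeStart p (i + 1) + 2 ^ (p + 1) = 2 ^ (p + i + 1) := by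
  induction i with
  | zero => simp [regimeStart]
  | succ i ih =>
    rw [regimeStart_succ (by omega), regimeLength, ← add_assoc p i 1]
    rw [pow_succ 2 (p + i + 1)]
    omega

/-- The bound for MOSS requires no more arms than its horizon; in the first regime the two are
equal. -/
theorem numArms_le_regimeLength {p i : ℕ} (hi : 1 ≤ i) (hip : i ≤ p) :
    numArms p i ≤ regimeLength p i := by
  unfold numArms numCells regimeLength
  obtain rfl | h2 := hi.eq_or_lt
  · simp
  · have h3 : 2 ^ (p + 2 - i) ≤ 2 ^ p := Nat.pow_le_pow_right (by norm_num) (by omega)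
    have h4 : p < 2 ^ p := Nat.lt_pow_self (by norm_num)
    have h5 : 2 ^ (p + 2) ≤ 2 ^ (p + i) := Nat.pow_le_pow_right (by norm_num) (by omega)
    rw [pow_add] at h5
    omega

theorem uniformCell_set_eq {K c : ℕ} (hK : 0 < K) (hc : c < K) :
    ∃ u v : Arm, {x : Arm | (c : ℝ) / K ≤ (x : ℝ) ∧ (x : ℝ) ≤ ((c : ℝ) + 1) / K} = Set.Icc u v ∧
      u < v := by
  have hKR : (0 : ℝ) < K := by exact_mod_cast hK
  have hcR : (c : ℝ) + 1 ≤ K := by exact_mod_cast hc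
  have h1 : (c : ℝ) / K ≤ 1 := by rw [div_le_one hKR]; linarith
  have h2 : ((c : ℝ) + 1) / K ≤ 1 := by rw [div_le_one hKR]; linarith
  refine ⟨⟨(c : ℝ) / K, by positivity, h1⟩, ⟨((c : ℝ) + 1) / K, by positivity, h2⟩, rfl, ?_⟩
  rw [← Subtype.coe_lt_coe]
  simp only
  gcongr
  linarith

theorem isProbabilityMeasure_uniformCell {K c : ℕ} (hK : 0 < K) (hc : c < K) :
    IsProbabilityMeasure (uniformCell K c) := by
  obtain ⟨u, v, h, huv⟩ := uniformCell_set_eq hK hc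
  refine cond_isProbabilityMeasure ?_
  rw [h, unitInterval.volume_Icc]
  simpa using huv

theorem ae_mem_uniformCell {K c : ℕ} (hK : 0 < K) (hc : c < K) :
    ∀ᵐ x : Arm ∂uniformCell K c, (c : ℝ) / K ≤ (x : ℝ) ∧ (x : ℝ) ≤ ((c : ℝ) + 1) / K := by
  obtain ⟨u, v, h, huv⟩ := uniformCell_set_eq hK hc
  have hm : MeasurableSet {x : Arm | (c : ℝ) / K ≤ (x : ℝ) ∧ (x : ℝ) ≤ ((c : ℝ) + 1) / K} := by
    rw [h]; exact measurableSet_Icc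
  exact ae_cond_mem hm

theorem isProbabilityMeasure_empiricalMeasure {p j : ℕ} (hj : 1 ≤ j) (x : ℕ → Arm) :
    IsProbabilityMeasure (empiricalMeasure p j x) := by
  constructor
  have h0 : (regimeLength p j : ENNReal) ≠ 0 := by simp [regimeLength]
  rw [empiricalMeasure, Measure.smul_apply, Measure.finsetSum_apply]
  simp only [measure_univ, Finset.sum_const, Nat.card_Ico, regimeStart_succ hj, smul_eq_mul,
    Nat.add_sub_cancel_left, nsmul_eq_mul, mul_one]
  exact ENNReal.inv_mul_cancel h0 (ENNReal.natCast_ne_top _)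

theorem isProbabilityMeasure_armMeasure (p i : ℕ) (x : ℕ → Arm) (c : ℕ) :
    IsProbabilityMeasure (armMeasure p i x c) := by
  unfold armMeasure
  split_ifs with h
  · exact isProbabilityMeasure_uniformCell (by unfold numCells; positivity) h
  · exact isProbabilityMeasure_empiricalMeasure (by omega) x

theorem integrable_of_mem_Icc {f : Arm → ℝ} (hfm : Measurable f) (hf : ∀ x, f x ∈ Set.Icc (0 : ℝ) 1)
    (ν : Measure Arm) [IsFiniteMeasure ν] : Integrable f ν :=
  Integrable.of_mem_Icc 0 1 hfm.aemeasurable (Filter.Eventually.of_forall hf)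

theorem integral_empiricalMeasure {f : Arm → ℝ} (hfm : Measurable f)
    (hf : ∀ x, f x ∈ Set.Icc (0 : ℝ) 1) (p j : ℕ) (x : ℕ → Arm) :
    ∫ z, f z ∂empiricalMeasure p j x =
      (∑ t ∈ Finset.Ico (regimeStart p j) (regimeStart p (j + 1)), f (x t)) / regimeLength p j := by
  rw [empiricalMeasure, integral_smul_measure,
    integral_finsetSum_measure fun t _ => integrable_of_mem_Icc hfm hf _]
  simp only [integral_dirac, ENNReal.toReal_inv, ENNReal.toReal_natCast, smul_eq_mul]
  rw [div_eq_inv_mul]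

/-- Mean of `f` under the measure attached to the discrete arm `b` in regime `i`. -/
noncomputable def armMean (f : Arm → ℝ) (p i : ℕ) (x : ℕ → Arm) (b : ℕ) : ℝ := ∫ z, f z ∂armMeasure p i x b

theorem armMean_mem {f : Arm → ℝ} (hfm : Measurable f) (hf : ∀ x, f x ∈ Set.Icc (0 : ℝ) 1)
    (p i : ℕ) (x : ℕ → Arm) (b : ℕ) : armMean f p i x b ∈ Set.Icc (0 : ℝ) 1 := by
  have := isProbabilityMeasure_armMeasure p i x b
  refine ⟨integral_nonneg fun z => (hf z).1, ?_⟩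
  calc armMean f p i x b ≤ ∫ _, (1 : ℝ) ∂armMeasure p i x b :=
        integral_mono (integrable_of_mem_Icc hfm hf _) (integrable_const _) fun z => (hf z).2
    _ = 1 := by simp

/-- Hoeffding's lemma for the measure attached to a discrete arm. -/
theorem integral_exp_armMeasure_le {f : Arm → ℝ} (hfm : Measurable f)
    (hf : ∀ x, f x ∈ Set.Icc (0 : ℝ) 1) (p i : ℕ) (x : ℕ → Arm) (b : ℕ) (s : ℝ) :
    Real.exp (-s * armMean f p i x b) * ∫ z, Real.exp (s * f z) ∂armMeasure p i x b ≤
      Real.exp (s ^ 2 / 8) := by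
  have := isProbabilityMeasure_armMeasure p i x b
  have h := (hasSubgaussianMGF_of_mem_Icc (μ := armMeasure p i x b) hfm.aemeasurable
    (Filter.Eventually.of_forall hf)).mgf_le s
  have e : Real.exp (-s * armMean f p i x b) * ∫ z, Real.exp (s * f z) ∂armMeasure p i x b =
      mgf (fun z => f z - ∫ x', f x' ∂armMeasure p i x b) (armMeasure p i x b) s := by
    rw [mgf, ← integral_const_mul]
    refine integral_congr_ae (Filter.Eventually.of_forall fun z => ?_)
    simp only
    rw [← Real.exp_add, armMean]; congr 1; ring
  rw [e]
  refine h.trans (Real.exp_le_exp.2 (le_of_eq ?_))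
  simp
  ring

/-- In each partition, a cell which contains `xs` has mean close to the maximum. -/
theorem exists_cell_mean_ge {f : Arm → ℝ} (hfm : Measurable f) {L α : ℝ} (hα : 0 < α) (hL : 0 ≤ L)
    (hf : f ∈ holderClass L α) (p i : ℕ) :
    ∃ c < numCells p i, ∀ x : ℕ → Arm,
      maxValue f - L * ((numCells p i : ℝ)⁻¹) ^ α ≤ armMean f p i x c := by
  obtain ⟨hf01, xs, hxs, hH⟩ := hf
  set K := numCells p i with hKdef
  have hK : 0 < K := by rw [hKdef]; unfold numCells; positivity
  have hKR : (0 : ℝ) < K := by exact_mod_cast hK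
  obtain ⟨hx0, hx1⟩ := xs.2
  have hcell : ∃ c < K, (c : ℝ) / K ≤ xs ∧ (xs : ℝ) ≤ ((c : ℝ) + 1) / K := by
    -- The floor would give the index `K` when `xs = 1`; that point goes to the last cell.
    rcases hx1.eq_or_lt with h1 | h1
    · refine ⟨K - 1, by omega, ?_⟩
      rw [Nat.cast_pred hK, h1, div_le_one hKR, le_div_iff₀ hKR]
      constructor <;> linarith
    · refine ⟨⌊(xs : ℝ) * K⌋₊, ?_, ?_, ?_⟩
      · rw [Nat.floor_lt (by positivity)]; nlinarith
      · rw [div_le_iff₀ hKR]; exact Nat.floor_le (by positivity)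
      · rw [le_div_iff₀ hKR]; exact (Nat.lt_floor_add_one _).le
  obtain ⟨c, hc, hcx⟩ := hcell
  refine ⟨c, hc, fun x => ?_⟩
  have hprob := isProbabilityMeasure_uniformCell hK hc
  rw [armMean, armMeasure, if_pos hc]
  calc maxValue f - L * ((K : ℝ)⁻¹) ^ α
      = ∫ _, (maxValue f - L * ((K : ℝ)⁻¹) ^ α) ∂uniformCell K c := by simp
    _ ≤ _ := by
      refine integral_mono_ae (integrable_const _) (integrable_of_mem_Icc hfm hf01 _) ?_
      filter_upwards [ae_mem_uniformCell hK hc] with z hz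
      have h1 := hH z
      rw [hxs] at h1
      have h2 := (le_abs_self _).trans h1
      have h3 : |(xs : ℝ) - z| ≤ (K : ℝ)⁻¹ := by
        have : ((c : ℝ) + 1) / K = c / K + (K : ℝ)⁻¹ := by field_simp
        rw [this] at hz hcx
        rw [abs_le]
        constructor <;> linarith [hz.1, hz.2, hcx.1, hcx.2]
      have h4 : L * |(xs : ℝ) - z| ^ α ≤ L * ((K : ℝ)⁻¹) ^ α := by gcongr
      linarith

variable {Ω : Type*} {I : ℕ → Ω → ℕ} {X : ℕ → Ω → Arm} {Y : ℕ → Ω → ℝ}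

theorem measurable_history {s t : ℕ} (h : s < t) :
    Measurable[history I X Y t] fun ω => (I s ω, X s ω, Y s ω) :=
  (comap_measurable _).mono (le_iSup (fun s : Fin t =>
    MeasurableSpace.comap (fun ω => (I s ω, X s ω, Y s ω)) inferInstance) ⟨s, h⟩) le_rfl

theorem history_le_historyI (t : ℕ) : history I X Y t ≤ historyI I X Y t := le_sup_left

theorem historyI_le_historyIX (t : ℕ) : historyI I X Y t ≤ historyIX I X Y t := le_sup_left

theorem measurable_index_historyI {s t : ℕ} (h : s ≤ t) : Measurable[historyI I X Y t] (I s) := by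
  rcases h.eq_or_lt with rfl | h
  · exact (comap_measurable _).mono le_sup_right le_rfl
  · exact (measurable_fst.comp (measurable_history h)).mono (history_le_historyI t) le_rfl

theorem measurable_reward_historyI {s t : ℕ} (h : s < t) : Measurable[historyI I X Y t] (Y s) :=
  ((measurable_snd.comp measurable_snd).comp (measurable_history h)).mono
    (history_le_historyI t) le_rfl

theorem measurable_arm_historyI {s t : ℕ} (h : s < t) : Measurable[historyI I X Y t] (X s) :=
  ((measurable_fst.comp measurable_snd).comp (measurable_history h)).mono
    (history_le_historyI t) le_rfl

/-- Memory arms refer only to regimes before `i`, all finished by the start of regime `i`. -/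
theorem measurable_armMean {f : Arm → ℝ} (hfm : Measurable f) (hf : ∀ x, f x ∈ Set.Icc (0 : ℝ) 1)
    {p i b t : ℕ} (hi : 1 ≤ i) (hb : b < numArms p i) (ht : regimeStart p i ≤ t) :
    Measurable[historyI I X Y t] fun ω => armMean f p i (fun s => X s ω) b := by
  unfold armMean armMeasure
  split_ifs with h
  · exact measurable_const
  · simp only [integral_empiricalMeasure hfm hf]
    refine Measurable.div_const (Finset.measurable_fun_sum _ fun s hs => ?_) _
    refine hfm.comp (measurable_arm_historyI ?_)
    have h1 : regimeStart p (b - numCells p i + 1 + 1) ≤ regimeStart p i := by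
      refine regimeStart_mono p ?_
      unfold numArms at hb
      omega
    have := (Finset.mem_Ico.1 hs).2
    omega

variable [m0 : MeasurableSpace Ω] {P : Measure Ω}

theorem history_le (hI : ∀ t, Measurable (I t)) (hX : ∀ t, Measurable (X t))
    (hY : ∀ t, Measurable (Y t)) (t : ℕ) : history I X Y t ≤ m0 :=
  iSup_le fun s => ((hI s).prodMk ((hX s).prodMk (hY s))).comap_le

theorem historyI_le (hI : ∀ t, Measurable (I t)) (hX : ∀ t, Measurable (X t))
    (hY : ∀ t, Measurable (Y t)) (t : ℕ) : historyI I X Y t ≤ m0 :=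
  sup_le (history_le hI hX hY t) (hI t).comap_le

theorem historyIX_le (hI : ∀ t, Measurable (I t)) (hX : ∀ t, Measurable (X t))
    (hY : ∀ t, Measurable (Y t)) (t : ℕ) : historyIX I X Y t ≤ m0 :=
  sup_le (historyI_le hI hX hY t) (hX t).comap_le

variable {f : Arm → ℝ} {T : ℕ} {B : ℝ}

theorem integral_reward [IsProbabilityMeasure P] (hEnv : IsEnvironment f T P I X Y)
    (hAlg : IsMedzo B T P I X Y) {t : ℕ} (ht : t < T) :
    ∫ ω, Y t ω ∂P = ∫ ω, f (X t ω) ∂P := by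
  rw [← integral_condExp (historyIX_le hAlg.measurable_index hAlg.measurable_arm
    hEnv.measurable_reward t)]
  exact integral_congr_ae (hEnv.mean_reward t ht)

/-- Two successive conditionings: given `X t`, the noise contributes `exp (s² / 8)`; then, given
only the discrete arm, the draw contributes another `exp (s² / 8)`. -/
theorem subgaussian_feedback [IsProbabilityMeasure P] (hfm : Measurable f)
    (hf : ∀ x, f x ∈ Set.Icc (0 : ℝ) 1) (hEnv : IsEnvironment f T P I X Y)
    (hAlg : IsMedzo B T P I X Y) {i t b : ℕ} (hreg : InRegime (numRegimes B) i t) (ht : t < T)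
    (hb : b < numArms (numRegimes B) i) (s : ℝ) {A : Set Ω}
    (hA : MeasurableSet[historyI I X Y t] A) (hAb : ∀ ω ∈ A, I t ω = b) :
    ∫⁻ ω in A, ENNReal.ofReal (Real.exp
        (s * (Y t ω - armMean f (numRegimes B) i (fun r => X r ω) b))) ∂P
      ≤ ENNReal.ofReal (Real.exp (s ^ 2 / 4)) * P A := by
  set p := numRegimes B with hp
  set M : Ω → ℝ := fun ω => armMean f p i (fun r => X r ω) b with hMdef
  have hIX := historyIX_le hAlg.measurable_index hAlg.measurable_arm hEnv.measurable_reward t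
  have hI := historyI_le hAlg.measurable_index hAlg.measurable_arm hEnv.measurable_reward t
  have hA0 : MeasurableSet A := hI A hA
  have hM : Measurable[historyI I X Y t] M := measurable_armMean hfm hf hreg.1 hb hreg.2.2.1
  have hfX : Measurable fun ω => f (X t ω) := hfm.comp (hAlg.measurable_arm t)
  have hXX : Measurable[historyIX I X Y t] (X t) := (comap_measurable _).mono le_sup_right le_rfl
  -- `W₀` is known before the draw of `X t`, and `W` before the reward.
  set W₀ : Ω → ENNReal := A.indicator fun ω => ENNReal.ofReal (Real.exp (-s * M ω)) with hW₀
  have hW₀m : Measurable[historyI I X Y t] W₀ :=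
    (Real.measurable_exp.comp (hM.const_mul (-s))).ennreal_ofReal.indicator hA
  set W : Ω → ENNReal := fun ω => W₀ ω * ENNReal.ofReal (Real.exp (s * f (X t ω))) with hW
  have hWm : Measurable[historyIX I X Y t] W :=
    (hW₀m.mono (historyI_le_historyIX t) le_rfl).mul
      (Real.measurable_exp.comp ((hfm.comp hXX).const_mul s)).ennreal_ofReal
  have h1 := lintegral_mul_ofReal_le_of_condExp_le hIX
    (g := fun ω => Real.exp (s * (Y t ω - f (X t ω))))
    (Real.measurable_exp.comp (((hEnv.measurable_reward t).sub hfX).const_mul s))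
    (hEnv.integrable_exp t ht s) (fun ω => (Real.exp_pos _).le) (hEnv.subgaussian t ht s) hWm
  have hgm : Measurable fun x : Arm => Real.exp (s * f x) :=
    Real.measurable_exp.comp (hfm.const_mul s)
  have hgb : ∀ x, |Real.exp (s * f x)| ≤ Real.exp |s| := by
    intro x
    rw [abs_of_pos (Real.exp_pos _)]
    refine Real.exp_le_exp.2 ((le_abs_self _).trans ?_)
    rw [abs_mul, abs_of_nonneg (hf x).1]
    exact mul_le_of_le_one_right (abs_nonneg _) (hf x).2
  have h2 := lintegral_mul_ofReal_le_of_condExp_le (P := P) hI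
    (g := fun ω => Real.exp (s * f (X t ω))) (hgm.comp (hAlg.measurable_arm t))
    (Integrable.of_bound (hgm.comp (hAlg.measurable_arm t)).aestronglyMeasurable (Real.exp |s|)
      (Filter.Eventually.of_forall fun ω => hgb _)) (fun ω => (Real.exp_pos _).le)
    (hAlg.draw i t hreg ht _ hgm ⟨_, hgb⟩).le hW₀m
  have h3 : ∫⁻ ω, W₀ ω * ENNReal.ofReal (∫ x, Real.exp (s * f x)
      ∂armMeasure p i (fun r => X r ω) (I t ω)) ∂P ≤
      ENNReal.ofReal (Real.exp (s ^ 2 / 8)) * P A := by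
    rw [← setLIntegral_const, ← lintegral_indicator hA0]
    refine lintegral_mono fun ω => ?_
    by_cases hω : ω ∈ A
    · simp only [hW₀, Set.indicator_of_mem hω]
      rw [hAb ω hω, ← ENNReal.ofReal_mul (Real.exp_pos _).le]
      exact ENNReal.ofReal_le_ofReal (integral_exp_armMeasure_le hfm hf p i _ b s)
    · simp [hW₀, hω]
  calc ∫⁻ ω in A, ENNReal.ofReal (Real.exp (s * (Y t ω - M ω))) ∂P
      = ∫⁻ ω, W ω * ENNReal.ofReal (Real.exp (s * (Y t ω - f (X t ω)))) ∂P := by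
        rw [← lintegral_indicator hA0]
        refine lintegral_congr fun ω => ?_
        by_cases hω : ω ∈ A
        · simp only [hW, hW₀, Set.indicator_of_mem hω]
          rw [← ENNReal.ofReal_mul (Real.exp_pos _).le, ← Real.exp_add,
            ← ENNReal.ofReal_mul (Real.exp_pos _).le, ← Real.exp_add]
          congr 2; ring
        · simp [hW, hW₀, hω]
    _ ≤ (∫⁻ ω, W ω ∂P) * ENNReal.ofReal (Real.exp (1 / 4 * s ^ 2 / 2)) := by
        rw [← lintegral_mul_const' _ _ ENNReal.ofReal_ne_top]
        exact h1
    _ ≤ (ENNReal.ofReal (Real.exp (s ^ 2 / 8)) * P A) *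
          ENNReal.ofReal (Real.exp (1 / 4 * s ^ 2 / 2)) := by
        gcongr
        exact h2.trans h3
    _ = _ := by
        rw [mul_right_comm, ← ENNReal.ofReal_mul (Real.exp_pos _).le, ← Real.exp_add]
        congr 3; ring

/-- Here `n` may be shorter than the regime, because the last one can be cut off at `T`. -/
theorem isFeedback_regime [IsProbabilityMeasure P] (hfm : Measurable f)
    (hf : ∀ x, f x ∈ Set.Icc (0 : ℝ) 1) (hEnv : IsEnvironment f T P I X Y)
    (hAlg : IsMedzo B T P I X Y) {i n : ℕ} (hi : 1 ≤ i) (hip : i ≤ numRegimes B)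
    (hn : n ≤ regimeLength (numRegimes B) i) (hnT : regimeStart (numRegimes B) i + n ≤ T) :
    IsFeedback P (fun t => historyI I X Y (regimeStart (numRegimes B) i + t))
      (numArms (numRegimes B) i) n (fun t => I (regimeStart (numRegimes B) i + t))
      (fun t => Y (regimeStart (numRegimes B) i + t))
      (fun b ω => armMean f (numRegimes B) i (fun s => X s ω) b) where
  le t := historyI_le hAlg.measurable_index hAlg.measurable_arm hEnv.measurable_reward _
  measurable_arm t s h := measurable_index_historyI (by omega)
  measurable_reward t s h := measurable_reward_historyI (by omega)
  measurable_mean t b hb := measurable_armMean hfm hf hi hb (by omega)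
  subgaussian t ht b hb s A hA hAb := by
    refine subgaussian_feedback hfm hf hEnv hAlg ⟨hi, hip, by omega, ?_⟩ (by omega) hb s hA hAb
    rw [regimeStart_succ hi]
    omega

/-- Regret during (the beginning of) a regime, with respect to the discrete arm `c`. -/
theorem regime_regret_le [IsProbabilityMeasure P] (hfm : Measurable f)
    (hf : ∀ x, f x ∈ Set.Icc (0 : ℝ) 1) (hEnv : IsEnvironment f T P I X Y)
    (hAlg : IsMedzo B T P I X Y) {i n c : ℕ} (hi : 1 ≤ i) (hip : i ≤ numRegimes B)
    (hn : n ≤ regimeLength (numRegimes B) i) (hnT : regimeStart (numRegimes B) i + n ≤ T)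
    (hc : c < numArms (numRegimes B) i) :
    ∑ t ∈ Finset.range n, ((∫ ω, armMean f (numRegimes B) i (fun s => X s ω) c ∂P) -
      ∫ ω, f (X (regimeStart (numRegimes B) i + t) ω) ∂P) ≤
      29 * √((numArms (numRegimes B) i : ℝ) * regimeLength (numRegimes B) i) := by
  set p := numRegimes B with hp
  have hF := isFeedback_regime hfm hf hEnv hAlg hi hip hn hnT
  have hreg : ∀ t < n, InRegime p i (regimeStart p i + t) := fun t ht =>
    ⟨hi, hip, by omega, by rw [regimeStart_succ hi]; omega⟩
  have hfb : ∀ x, |f x| ≤ 1 := fun x => abs_le.2 ⟨by linarith [(hf x).1], (hf x).2⟩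
  have hdraw : ∀ t < n, P[fun ω => f (X (regimeStart p i + t) ω) |
      historyI I X Y (regimeStart p i + t)] =ᵐ[P]
      fun ω => armMean f p i (fun s => X s ω) (I (regimeStart p i + t) ω) := fun t ht =>
    hAlg.draw i _ (hreg t ht) (by omega) f hfm ⟨1, hfb⟩
  have hi1 : ∀ t < n, Integrable
      (fun ω => armMean f p i (fun s => X s ω) (I (regimeStart p i + t) ω)) P := fun t ht =>
    integrable_condExp.congr (hdraw t ht)
  have hi2 : Integrable (fun ω => armMean f p i (fun s => X s ω) c) P :=
    Integrable.of_mem_Icc 0 1 (hF.measurable_all.2.2 c hc).aemeasurable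
      (Filter.Eventually.of_forall fun ω => armMean_mem hfm hf p i _ c)
  have hi3 : ∀ t ∈ Finset.range n, Integrable (fun ω => armMean f p i (fun s => X s ω) c -
      armMean f p i (fun s => X s ω) (I (regimeStart p i + t) ω)) P := fun t ht =>
    hi2.sub (hi1 t (Finset.mem_range.1 ht))
  have hmain := moss_regret_le hF (H := regimeLength p i) (numArms_le_regimeLength hi hip) hn hc
    (fun t ht => by
      have := hAlg.choice i _ (hreg t ht) (by omega)
      rw [← hp, Nat.add_sub_cancel_left] at this
      exact this)
    (fun ω b _ => armMean_mem hfm hf p i _ b) (integrable_finsetSum _ hi3)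
  rw [integral_finsetSum _ hi3] at hmain
  refine le_trans (le_of_eq (Finset.sum_congr rfl fun t ht => ?_)) hmain
  have htn := Finset.mem_range.1 ht
  rw [integral_sub hi2 (hi1 t htn), ← integral_congr_ae (hdraw t htn), integral_condExp (hF.le t)]

end Medzo

/-! ### Summation over the regimes and choice of the scale. -/

namespace Medzo

theorem numArms_mul_regimeLength_le {p i : ℕ} (hi : 1 ≤ i) (hip : i ≤ p) :
    √((numArms p i : ℝ) * regimeLength p i) ≤ 2 ^ (p + 1) * √(p : ℝ) := by
  have h : numArms p i * regimeLength p i ≤ (2 ^ (p + 1)) ^ 2 * p := by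
    unfold numArms numCells regimeLength
    have h1 : 2 ^ (p + 2 - i) * 2 ^ (p + i) = (2 ^ (p + 1)) ^ 2 := by
      rw [← pow_add, ← pow_mul]; congr 1; omega
    have h2 : 2 ^ (p + i) ≤ (2 ^ (p + 1)) ^ 2 := by
      rw [← pow_mul]; exact Nat.pow_le_pow_right (by norm_num) (by omega)
    calc (2 ^ (p + 2 - i) + (i - 1)) * 2 ^ (p + i)
        = 2 ^ (p + 2 - i) * 2 ^ (p + i) + (i - 1) * 2 ^ (p + i) := by ring
      _ ≤ (2 ^ (p + 1)) ^ 2 + (p - 1) * (2 ^ (p + 1)) ^ 2 := by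
          rw [h1]; gcongr
      _ = ((p - 1) + 1) * (2 ^ (p + 1)) ^ 2 := by ring
      _ = _ := by rw [Nat.sub_add_cancel (by omega), mul_comm]
  have h' : (numArms p i : ℝ) * regimeLength p i ≤ (2 ^ (p + 1)) ^ 2 * p := by exact_mod_cast h
  calc _ ≤ √(((2 : ℝ) ^ (p + 1)) ^ 2 * p) := Real.sqrt_le_sqrt h'
    _ = _ := by rw [Real.sqrt_mul (by positivity), Real.sqrt_sq (by positivity)]

/-- Horizon and number of regimes, for the input `√T`. -/
theorem numRegimes_sqrt {T : ℕ} (hT : 2 ≤ T) :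
    1 ≤ numRegimes √(T : ℝ) ∧ √(T : ℝ) ≤ 2 ^ numRegimes √(T : ℝ) ∧
      (2 : ℝ) ^ numRegimes √(T : ℝ) ≤ 2 * √(T : ℝ) ∧
      (numRegimes √(T : ℝ) : ℝ) ≤ Real.logb 2 T ∧ 1 ≤ Real.logb 2 T := by
  have hTR : (2 : ℝ) ≤ T := by exact_mod_cast hT
  have hT0 : (0 : ℝ) < T := by linarith
  have hs : 0 < √(T : ℝ) := Real.sqrt_pos.2 hT0
  have hl : 1 ≤ Real.logb 2 T := by
    rw [Real.le_logb_iff_rpow_le (by norm_num) hT0]; simpa using hTR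
  have hls : Real.logb 2 √(T : ℝ) = Real.logb 2 T / 2 := by
    rw [Real.logb, Real.log_sqrt hT0.le, Real.logb]; ring
  unfold numRegimes
  rw [hls]
  set l := Real.logb 2 T with hldef
  have hrp : (2 : ℝ) ^ (l / 2) = √(T : ℝ) := by
    rw [← hls, Real.rpow_logb (by norm_num) (by norm_num) hs]
  have hp : l / 2 ≤ ⌈l / 2⌉₊ := Nat.le_ceil _
  have hp' : (⌈l / 2⌉₊ : ℝ) < l / 2 + 1 := Nat.ceil_lt_add_one (by linarith)
  refine ⟨Nat.one_le_iff_ne_zero.2 (Nat.ceil_pos.2 (by linarith)).ne', ?_, ?_, ?_, hl⟩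
  · rw [← hrp, ← Real.rpow_natCast]
    exact Real.rpow_le_rpow_of_exponent_le (by norm_num) hp
  · calc (2 : ℝ) ^ ⌈l / 2⌉₊ = (2 : ℝ) ^ (⌈l / 2⌉₊ : ℝ) := (Real.rpow_natCast _ _).symm
      _ ≤ (2 : ℝ) ^ (l / 2 + 1) := Real.rpow_le_rpow_of_exponent_le (by norm_num) hp'.le
      _ = 2 * √(T : ℝ) := by rw [Real.rpow_add (by norm_num), hrp, Real.rpow_one, mul_comm]
  · rcases le_total l 2 with h | h
    · have : ⌈l / 2⌉₊ ≤ 1 := Nat.ceil_le.2 (by norm_num; linarith)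
      have : (⌈l / 2⌉₊ : ℝ) ≤ 1 := by exact_mod_cast this
      linarith
    · linarith

/-- The regimes last `2 ^ (2p + 1) - 2 ^ (p + 1)` rounds in total, at least `2 ^ (2p)`, so the
algorithm never runs out of them. -/
theorem le_regimeStart {T p : ℕ} (hp : 1 ≤ p) (h : √(T : ℝ) ≤ 2 ^ p) : T ≤ regimeStart p (p + 1) := by
  have h1 : (T : ℝ) ≤ (2 ^ p) ^ 2 := (Real.sqrt_le_left (by positivity)).1 h
  have h2 : T ≤ (2 ^ p) ^ 2 := by exact_mod_cast h1
  have h3 := regimeStart_add p p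
  have h4 : 2 ^ (p + p + 1) = 2 * (2 ^ p) ^ 2 := by rw [pow_succ, pow_add]; ring
  have h5 : 2 ^ (p + 1) ≤ (2 ^ p) ^ 2 := by
    rw [← pow_mul]; exact Nat.pow_le_pow_right (by norm_num) (by omega)
  omega

/-- A power of two which is at least `4` and `Q`, and close to `Q` if it is larger than `4`. -/
theorem exists_scale {Q : ℝ} {p : ℕ} (hp : 1 ≤ p) (hQ : Q ≤ 2 ^ (p + 1)) :
    ∃ m, 2 ≤ m ∧ m ≤ p + 1 ∧ Q ≤ 2 ^ m ∧ (m = 2 ∨ (2 : ℝ) ^ m ≤ 2 * Q) := by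
  classical
  have hex : ∃ m, 2 ≤ m ∧ Q ≤ 2 ^ m := ⟨p + 1, by omega, hQ⟩
  obtain ⟨h1, h2⟩ := Nat.find_spec hex
  refine ⟨Nat.find hex, h1, Nat.find_min' hex ⟨by omega, hQ⟩, h2, ?_⟩
  by_cases h : Nat.find hex = 2
  · exact Or.inl h
  · right
    have h3 := Nat.find_min hex (m := Nat.find hex - 1) (by omega)
    have h4 : (2 : ℝ) ^ (Nat.find hex - 1) < Q := by
      by_contra h5
      exact h3 ⟨by omega, not_lt.1 h5⟩
    have h6 : (2 : ℝ) ^ Nat.find hex = 2 ^ (Nat.find hex - 1) * 2 := by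
      rw [← pow_succ, Nat.sub_add_cancel (by omega)]
    rw [h6]
    linarith

theorem sum_regimes_eq (p T : ℕ) (r : ℕ → ℝ) (k : ℕ) :
    ∑ i ∈ Finset.Ico 1 (k + 1), ∑ t ∈ Finset.Ico (min (regimeStart p i) T)
      (min (regimeStart p (i + 1)) T), r t =
    ∑ t ∈ Finset.range (min (regimeStart p (k + 1)) T), r t := by
  induction k with
  | zero => simp [regimeStart]
  | succ k ih =>
    rw [Finset.sum_Ico_succ_top (by omega), ih, Finset.range_eq_Ico, Finset.range_eq_Ico,
      Finset.sum_Ico_consecutive _ (Nat.zero_le _)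
        (min_le_min_right _ (regimeStart_mono p (by omega)))]

variable {Ω : Type*} [m0 : MeasurableSpace Ω] {P : Measure Ω} {I : ℕ → Ω → ℕ} {X : ℕ → Ω → Arm}
  {Y : ℕ → Ω → ℝ} {f : Arm → ℝ} {T : ℕ} {B : ℝ}

theorem regret_eq_sum [IsProbabilityMeasure P] (hEnv : IsEnvironment f T P I X Y)
    (hAlg : IsMedzo B T P I X Y) :
    regret f T P Y = ∑ t ∈ Finset.range T, (maxValue f - ∫ ω, f (X t ω) ∂P) := by
  rw [regret, integral_finsetSum _ fun t ht => hEnv.integrable_reward t (Finset.mem_range.1 ht),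
    Finset.sum_sub_distrib, Finset.sum_const, Finset.card_range, nsmul_eq_mul]
  congr 1
  exact Finset.sum_congr rfl fun t ht => integral_reward hEnv hAlg (Finset.mem_range.1 ht)

theorem sum_regime_le [IsProbabilityMeasure P] (hfm : Measurable f)
    (hf : ∀ x, f x ∈ Set.Icc (0 : ℝ) 1) (hEnv : IsEnvironment f T P I X Y)
    (hAlg : IsMedzo B T P I X Y) {p : ℕ} (hpB : numRegimes B = p) {i c : ℕ} (hi : 1 ≤ i)
    (hip : i ≤ p) (hiT : regimeStart p i < T) (hc : c < numArms p i) {D : ℝ}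
    (hD : maxValue f - ∫ ω, armMean f p i (fun s => X s ω) c ∂P ≤ D) :
    ∑ t ∈ Finset.Ico (min (regimeStart p i) T) (min (regimeStart p (i + 1)) T),
      (maxValue f - ∫ ω, f (X t ω) ∂P) ≤
    ((min (regimeStart p (i + 1)) T - min (regimeStart p i) T : ℕ) : ℝ) * D +
      29 * (2 ^ (p + 1) * √(p : ℝ)) := by
  subst hpB
  set p := numRegimes B with hp
  rw [min_eq_left hiT.le, Finset.sum_Ico_eq_sum_range]
  set n := min (regimeStart p (i + 1)) T - regimeStart p i with hn
  have h1 : n ≤ regimeLength p i := by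
    have := regimeStart_succ (p := p) hi
    omega
  have h2 := regime_regret_le (n := n) hfm hf hEnv hAlg hi hip h1
    (show regimeStart p i + n ≤ T by omega) hc
  rw [← hp] at h2
  have h3 := numArms_mul_regimeLength_le hi hip
  rw [Finset.sum_sub_distrib, Finset.sum_const, Finset.card_range, nsmul_eq_mul] at h2 ⊢
  have h4 := mul_le_mul_of_nonneg_left hD (Nat.cast_nonneg (α := ℝ) n)
  linarith

/-- `G` is the price of relying on the memory of regime `p + 2 - m`. For `m = 2` that is the last
regime, nobody relies on it, and `G` is unconstrained. -/
theorem regret_le_of_scale [IsProbabilityMeasure P] (hfm : Measurable f) {L α : ℝ} (hα : 0 < α)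
    (hL : 0 ≤ L) (hf : f ∈ holderClass L α) (hEnv : IsEnvironment f T P I X Y)
    (hAlg : IsMedzo B T P I X Y) {p m : ℕ} (hpB : numRegimes B = p) (hm : 2 ≤ m) (hmp : m ≤ p + 1)
    (hpT : T ≤ regimeStart p (p + 1)) {G : ℝ} (hG0 : 0 ≤ G)
    (hG : m ≠ 2 → 29 * (2 ^ (p + 1) * √(p : ℝ)) / regimeLength p (p + 2 - m) ≤ G) :
    regret f T P Y ≤ T * (L * (((2 : ℝ) ^ m)⁻¹) ^ α + G) +
      p * (29 * (2 ^ (p + 1) * √(p : ℝ))) := by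
  have hf01 := hf.1
  set D := L * (((2 : ℝ) ^ m)⁻¹) ^ α with hD
  set s : ℝ := 29 * (2 ^ (p + 1) * √(p : ℝ)) with hs
  have hs0 : 0 ≤ s := by positivity
  set j := p + 2 - m with hj
  have hj1 : 1 ≤ j := by omega
  have hjp : j ≤ p := by omega
  set r : ℕ → ℝ := fun t => maxValue f - ∫ ω, f (X t ω) ∂P with hr
  have hcell : ∀ i, 1 ≤ i → i ≤ j → regimeStart p i < T →
      ∑ t ∈ Finset.Ico (min (regimeStart p i) T) (min (regimeStart p (i + 1)) T), r t ≤
      ((min (regimeStart p (i + 1)) T - min (regimeStart p i) T : ℕ) : ℝ) * D + s := by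
    intro i hi hij hiT
    obtain ⟨c, hc, hcm⟩ := exists_cell_mean_ge hfm hα hL hf p i
    have hcA : c < numArms p i := hc.trans_le (Nat.le_add_right _ _)
    refine sum_regime_le hfm hf01 hEnv hAlg hpB hi (by omega) hiT hcA ?_
    have h1 : maxValue f - L * ((numCells p i : ℝ)⁻¹) ^ α ≤
        ∫ ω, armMean f p i (fun s => X s ω) c ∂P := by
      calc _ = ∫ _, (maxValue f - L * ((numCells p i : ℝ)⁻¹) ^ α) ∂P := by simp
        _ ≤ _ := by
          refine integral_mono (integrable_const _) ?_ fun ω => hcm _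
          exact Integrable.of_mem_Icc 0 1 ((measurable_armMean (Y := Y) hfm hf01 hi hcA le_rfl).mono
            (historyI_le hAlg.measurable_index hAlg.measurable_arm hEnv.measurable_reward _)
            le_rfl).aemeasurable (Filter.Eventually.of_forall fun ω => armMean_mem hfm hf01 p i _ c)
    have h2 : L * ((numCells p i : ℝ)⁻¹) ^ α ≤ D := by
      rw [hD]
      gcongr
      unfold numCells
      push_cast
      exact pow_le_pow_right₀ (by norm_num) (by omega)
    linarith
  have hreg : ∀ i ∈ Finset.Ico 1 (p + 1),
      ∑ t ∈ Finset.Ico (min (regimeStart p i) T) (min (regimeStart p (i + 1)) T), r t ≤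
      ((min (regimeStart p (i + 1)) T - min (regimeStart p i) T : ℕ) : ℝ) * (D + G) + s := by
    intro i hi
    obtain ⟨hi1, hip⟩ := Finset.mem_Ico.1 hi
    rcases le_or_gt T (regimeStart p i) with hiT | hiT
    · have h1 : T ≤ regimeStart p (i + 1) := hiT.trans (regimeStart_mono p (by omega))
      rw [min_eq_right hiT, min_eq_right h1]
      simpa using hs0
    rcases le_or_gt i j with hij | hij
    · refine (hcell i hi1 hij hiT).trans ?_
      have : (0 : ℝ) ≤ ((min (regimeStart p (i + 1)) T - min (regimeStart p i) T : ℕ) : ℝ) * G :=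
        mul_nonneg (Nat.cast_nonneg _) hG0
      linarith
    -- Past regime `j`, the competitor is the memory arm of `j`.
    · have hcA : numCells p i + (j - 1) < numArms p i := by unfold numArms; omega
      refine sum_regime_le hfm hf01 hEnv hAlg hpB hi1 (by omega) hiT hcA ?_
      -- As a later regime starts before `T`, regime `j` ran to its end, and its empirical measure
      -- averages over actual rounds.
      have hjT : regimeStart p (j + 1) ≤ T := (regimeStart_mono p (by omega)).trans hiT.le
      have hjlt : regimeStart p j < regimeStart p (j + 1) := by
        rw [regimeStart_succ hj1]; unfold regimeLength; simp
      have hΔ : (0 : ℝ) < regimeLength p j := by unfold regimeLength; positivity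
      have h1 := hcell j hj1 le_rfl (by omega)
      rw [min_eq_left hjT, min_eq_left (by omega : regimeStart p j ≤ T)] at h1
      have h2 : regimeStart p (j + 1) - regimeStart p j = regimeLength p j := by
        rw [regimeStart_succ hj1]; omega
      rw [h2, hr, Finset.sum_sub_distrib, Finset.sum_const, Nat.card_Ico, h2, nsmul_eq_mul] at h1
      have h3 : ∫ ω, armMean f p i (fun s => X s ω) (numCells p i + (j - 1)) ∂P =
          (∑ t ∈ Finset.Ico (regimeStart p j) (regimeStart p (j + 1)), ∫ ω, f (X t ω) ∂P) /
            regimeLength p j := by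
        have h4 : ∀ ω, armMean f p i (fun s => X s ω) (numCells p i + (j - 1)) =
            (∑ t ∈ Finset.Ico (regimeStart p j) (regimeStart p (j + 1)), f (X t ω)) /
              regimeLength p j := by
          intro ω
          rw [armMean, armMeasure, if_neg (by omega),
            show numCells p i + (j - 1) - numCells p i + 1 = j by omega,
            integral_empiricalMeasure hfm hf01]
        simp only [h4]
        rw [integral_div, integral_finsetSum]
        intro t _
        exact Integrable.of_mem_Icc 0 1 (hfm.comp (hAlg.measurable_arm t)).aemeasurable
          (Filter.Eventually.of_forall fun ω => hf01 _)
      rw [h3]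
      have h5 : s / regimeLength p j ≤ G := hG (by omega)
      rw [div_le_iff₀ hΔ] at h5
      rw [sub_le_iff_le_add, ← sub_le_iff_le_add', le_div_iff₀ hΔ]
      linarith
  have hsum := Finset.sum_le_sum hreg
  rw [sum_regimes_eq, min_eq_right hpT, ← regret_eq_sum hEnv hAlg, Finset.sum_add_distrib,
    ← Finset.sum_mul, Finset.sum_const, Nat.card_Ico, Nat.add_sub_cancel, nsmul_eq_mul] at hsum
  -- The truncated regime lengths add up to `T`: the same decomposition applied to the constant `1`.
  have hcount := sum_regimes_eq p T (fun _ => (1 : ℝ)) p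
  simp only [Finset.sum_const, Nat.card_Ico, Finset.card_range, nsmul_eq_mul, mul_one] at hcount
  rw [hcount, min_eq_right hpT] at hsum
  exact hsum

theorem maxValue_le_one (hf : ∀ x, f x ∈ Set.Icc (0 : ℝ) 1) : maxValue f ≤ 1 :=
  ciSup_le fun x => (hf x).2

theorem regret_le_horizon [IsProbabilityMeasure P] (hf : ∀ x, f x ∈ Set.Icc (0 : ℝ) 1)
    (hEnv : IsEnvironment f T P I X Y) (hAlg : IsMedzo B T P I X Y) : regret f T P Y ≤ T := by
  rw [regret_eq_sum hEnv hAlg]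
  calc _ ≤ ∑ t ∈ Finset.range T, (1 : ℝ) := by
        refine Finset.sum_le_sum fun t _ => ?_
        have h1 := maxValue_le_one hf
        have h2 : 0 ≤ ∫ ω, f (X t ω) ∂P := integral_nonneg fun ω => (hf _).1
        linarith
    _ = T := by simp

end Medzo

theorem corollary3 (T : ℕ) (hT : 2 ≤ T) (α L : ℝ) (hα : 0 < α) (hL : 1 / Real.sqrt T < L)
    (f : Medzo.Arm → ℝ) (hfm : Measurable f) (hf : f ∈ Medzo.holderClass L α)
    {Ω : Type*} [MeasurableSpace Ω] (P : Measure Ω) [IsProbabilityMeasure P]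
    (I : ℕ → Ω → ℕ) (X : ℕ → Ω → Medzo.Arm) (Y : ℕ → Ω → ℝ)
    (hEnv : Medzo.IsEnvironment f T P I X Y)
    (hAlg : Medzo.IsMedzo (Real.sqrt T) T P I X Y) :
    Medzo.regret f T P Y ≤
      146 * Real.logb 2 T ^ (3 / 2 : ℝ) * L ^ (1 / (α + 1)) *
        (T : ℝ) ^ ((α + 2) / (2 * α + 2)) := by
  obtain ⟨hp1, hpT, hp2, hpl, hl⟩ := Medzo.numRegimes_sqrt hT
  set p := Medzo.numRegimes √(T : ℝ) with hp
  set l := Real.logb 2 T with hldef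
  have hT0 : (0 : ℝ) < T := by positivity
  set S := √(T : ℝ) with hS
  have hS0 : 0 < S := Real.sqrt_pos.2 hT0
  have hS2 : S ^ 2 = T := Real.sq_sqrt hT0.le
  have hL0 : 0 < L := (by positivity : (0 : ℝ) < 1 / S).trans hL
  have hLS : 1 ≤ L * S := by
    rw [div_lt_iff₀ hS0] at hL
    exact hL.le
  -- The ideal number of cells, solving `L S = Q ^ α · Q`; the target rate is then `S Q`. The lower
  -- bound on `L` gives `Q ≥ 1`.
  set Q := (L * S) ^ (1 / (α + 1)) with hQ
  have hα1 : 0 < α + 1 := by linarith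
  have hQ1 : 1 ≤ Q := Real.one_le_rpow hLS (by positivity)
  have hQ0 : 0 < Q := by linarith
  have htarget : 146 * l ^ (3 / 2 : ℝ) * L ^ (1 / (α + 1)) * (T : ℝ) ^ ((α + 2) / (2 * α + 2)) =
      146 * l ^ (3 / 2 : ℝ) * (S * Q) := by
    have h1 : (T : ℝ) ^ ((α + 2) / (2 * α + 2)) = S * S ^ (1 / (α + 1)) := by
      rw [hS, Real.sqrt_eq_rpow, ← Real.rpow_mul hT0.le, ← Real.rpow_add hT0]
      congr 1
      field_simp
      ring
    rw [h1, hQ, Real.mul_rpow hL0.le hS0.le]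
    ring
  rw [htarget]
  have hl32 : l ^ (3 / 2 : ℝ) = l * √l := by
    rw [Real.sqrt_eq_rpow, ← Real.rpow_one_add' (by linarith) (by norm_num)]
    norm_num
  have hsl : 1 ≤ √l := by rw [Real.one_le_sqrt]; exact hl
  rw [hl32]
  have hSQ : 0 < S * Q := by positivity
  have hll : 1 ≤ l * √l := by nlinarith
  -- If `Q` exceeds the finest partition, then `Q ≥ S` and the trivial bound `T = S²` is already
  -- below `S Q`.
  rcases le_or_gt Q (2 ^ (p + 1)) with hQp | hQp
  · obtain ⟨m, hm2, hmp, hQm, hm⟩ := Medzo.exists_scale hp1 hQp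
    have hsp : √(p : ℝ) ≤ √l := Real.sqrt_le_sqrt hpl
    have hmain := Medzo.regret_le_of_scale hfm hα hL0.le hf hEnv hAlg hp.symm hm2 hmp
      (Medzo.le_regimeStart hp1 hpT) (G := 29 * (√(p : ℝ) * Q / S)) (by positivity) (fun hne => by
        have h2Q := hm.resolve_left hne
        have hlen : (Medzo.regimeLength p (p + 2 - m) : ℝ) * 2 ^ m = (2 ^ (p + 1)) ^ 2 := by
          unfold Medzo.regimeLength
          push_cast
          rw [← pow_add, ← pow_mul]
          congr 1
          omega
        have hlen0 : (0 : ℝ) < Medzo.regimeLength p (p + 2 - m) := by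
          unfold Medzo.regimeLength; positivity
        rw [mul_div_assoc]
        refine mul_le_mul_of_nonneg_left ?_ (by norm_num)
        rw [div_le_div_iff₀ hlen0 hS0]
        have h3 : S * 2 ^ (p + 1) ≤ Q * Medzo.regimeLength p (p + 2 - m) := by
          have h4 : S * 2 ^ (p + 1) * 2 ^ m ≤
              Q * Medzo.regimeLength p (p + 2 - m) * 2 ^ m := by
            rw [mul_assoc Q, hlen]
            -- This uses `S ≤ 2 ^ p` and `2 ^ m ≤ 2 Q`, the latter available because `m ≠ 2`.
            calc S * 2 ^ (p + 1) * 2 ^ m ≤ 2 ^ p * 2 ^ (p + 1) * (2 * Q) := by gcongr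
              _ = _ := by ring
          exact le_of_mul_le_mul_right h4 (by positivity)
        calc 2 ^ (p + 1) * √(p : ℝ) * S = √(p : ℝ) * (S * 2 ^ (p + 1)) := by ring
          _ ≤ √(p : ℝ) * (Q * Medzo.regimeLength p (p + 2 - m)) := by gcongr
          _ = _ := by ring)
    refine hmain.trans ?_
    have hD : (T : ℝ) * (L * (((2 : ℝ) ^ m)⁻¹) ^ α) ≤ S * Q := by
      have h1 : (((2 : ℝ) ^ m)⁻¹) ^ α ≤ (Q⁻¹) ^ α := by gcongr
      have h2 : L * S = Q ^ α * Q := by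
        rw [← Real.rpow_add_one hQ0.ne', hQ, ← Real.rpow_mul (by positivity),
          one_div_mul_cancel hα1.ne', Real.rpow_one]
      calc (T : ℝ) * (L * (((2 : ℝ) ^ m)⁻¹) ^ α) ≤ T * (L * (Q⁻¹) ^ α) := by gcongr
        _ = S * (L * S) * (Q⁻¹) ^ α := by rw [← hS2]; ring
        _ = S * Q * (Q ^ α * (Q⁻¹) ^ α) := by rw [h2]; ring
        _ = S * Q := by
            rw [Real.inv_rpow hQ0.le, mul_inv_cancel₀ (Real.rpow_pos_of_pos hQ0 α).ne', mul_one]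
    have hGT : (T : ℝ) * (29 * (√(p : ℝ) * Q / S)) ≤ 29 * (l * √l) * (S * Q) := by
      have : (T : ℝ) * (29 * (√(p : ℝ) * Q / S)) = 29 * √(p : ℝ) * (S * Q) := by
        rw [← hS2]; field_simp
      rw [this]
      gcongr
      nlinarith
    have hlast : (p : ℝ) * (29 * (2 ^ (p + 1) * √(p : ℝ))) ≤ 116 * (l * √l) * (S * Q) := by
      calc (p : ℝ) * (29 * (2 ^ (p + 1) * √(p : ℝ)))
          = 58 * ((p : ℝ) * √(p : ℝ)) * 2 ^ p := by ring
        _ ≤ 58 * (l * √l) * (2 * S) := by gcongr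
        _ = 116 * (l * √l) * (S * 1) := by ring
        _ ≤ _ := by gcongr
    -- The constant is `146 = 1 + 29 + 116`: approximation by cells, memory, and the regret of MOSS
    -- over the `p` regimes.
    have hfirst : S * Q ≤ 1 * (l * √l) * (S * Q) := by
      rw [one_mul]
      exact le_mul_of_one_le_left hSQ.le hll
    linarith
  · have hSQ' : S ≤ Q := by
      refine hpT.trans (le_trans ?_ hQp.le)
      exact pow_le_pow_right₀ (by norm_num) (by omega)
    calc Medzo.regret f T P Y ≤ T := Medzo.regret_le_horizon hf.1 hEnv hAlg
      _ = S * S := by rw [← hS2]; ring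
      _ ≤ S * Q := by gcongr
      _ ≤ 146 * (l * √l) * (S * Q) := le_mul_of_one_le_left hSQ.le (by linarith)
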